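/- Definitions. A *pentagon* is a simple closed polygon in the Euclidean plane with five distinct vertices, together with the region it bounds (it need not be convex, and an interior angle equal to $\pi$ is allowed). A pentagon is *Prismatic* (respectively *Cairo*) if it has two adjacent (respectively two nonadjacent) right angles and three angles $2\pi/3$, and is circumscribed about a circle. A unit-area pentagon is *efficient* if its perimeter is at most that of a unit-area Cairo pentagon. A pentagon is *Type 1 non-convex* if exactly one of its interior angles is larger than $\pi$, and *Type 2 non-convex* if exactly two of its interior angles are larger than $\pi$. A tiling is *edge-to-edge* if different tiles meet only along entire edges or at vertices. The *perimeter* of a tiling of a flat torus is the total length of its edges, each edge being counted once; the *perimeter per tile* is the perimeter divided by the number of tiles. Proposition. Let $T$ be an edge-to-edge tiling of a flat torus $\mathbb{R}^2/\Lambda$ ($\Lambda$ a lattice of rank two) by finitely many unit-area pentagons, with perimeter per tile less than or equal to half the perimeter of a unit-area Prismatic pentagon. Then the fractions $C_1$, $N_1$ and $N_2$ of efficient, Type 1 non-convex and Type 2 non-convex pentagons among the tiles of $T$ satisfy $$C_1 > 2.6\,N_1 + 13.4\,N_2 .$$ -/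

import Mathlib

open scoped Pointwise Topology

/-- A pentagon in the Euclidean plane `ℂ`: a closed polygon with five distinct vertices, listed in
cyclic order, without self-intersections (two different edges meet only in a common endpoint).
Indices are taken modulo 5. -/
structure Pentagon where
  vertex : Fin 5 → ℂ
  injective : Function.Injective vertex
  simple : ∀ k l : Fin 5, k ≠ l →
    segment ℝ (vertex k) (vertex (k + 1)) ∩ segment ℝ (vertex l) (vertex (l + 1)) =
      {vertex k, vertex (k + 1)} ∩ {vertex l, vertex (l + 1)}

namespace Pentagon

/-- The `k`-th edge, as a set of points. -/
def edge (P : Pentagon) (k : Fin 5) : Set ℂ :=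
  segment ℝ (P.vertex k) (P.vertex (k + 1))

/-- The length of the `k`-th edge. -/
noncomputable def edgeLength (P : Pentagon) (k : Fin 5) : ℝ :=
  dist (P.vertex k) (P.vertex (k + 1))

theorem diam_edge (P : Pentagon) (k : Fin 5) : Metric.diam (P.edge k) = P.edgeLength k := by
  rw [edge, edgeLength, ← convexHull_pair, convexHull_diam, Metric.diam_pair]

/-- The perimeter of the pentagon: the sum of its edge lengths. -/
noncomputable def perimeter (P : Pentagon) : ℝ :=
  ∑ k, P.edgeLength k

/-- The polygonal curve that bounds the pentagon. -/
def boundary (P : Pentagon) : Set ℂ :=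
  ⋃ k, P.edge k

/-- The open region enclosed by the pentagon: the points off the boundary curve whose connected
component in the complement of that curve is bounded. -/
def inside (P : Pentagon) : Set ℂ :=
  {z | z ∉ P.boundary ∧ Bornology.IsBounded (connectedComponentIn P.boundaryᶜ z)}

/-- The closed region of the pentagon. -/
def region (P : Pentagon) : Set ℂ :=
  P.boundary ∪ P.inside

/-- The area of the pentagon (Lebesgue measure of its region). -/
noncomputable def area (P : Pentagon) : ℝ :=
  (MeasureTheory.volume : MeasureTheory.Measure ℂ).real P.region

/-- The interior angle at the `k`-th vertex, in radians: the measure of the set of directions that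
point from this vertex into the pentagon. -/
noncomputable def interiorAngle (P : Pentagon) (k : Fin 5) : ℝ :=
  (MeasureTheory.volume : MeasureTheory.Measure ℝ).real
    {θ | θ ∈ Set.Ioc (-Real.pi) Real.pi ∧
      ∀ᶠ t : ℝ in 𝓝[>] 0, P.vertex k + t * Complex.exp (θ * Complex.I) ∈ P.inside}

/-- The pentagon is circumscribed about a circle: each edge is tangent to that circle. -/
def IsCircumscribed (P : Pentagon) : Prop :=
  ∃ (c : ℂ) (r : ℝ), 0 < r ∧ ∀ k, ∃ t ∈ P.edge k,
    dist t c = r ∧ inner ℝ (t - c) (P.vertex (k + 1) - P.vertex k) = 0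

/-- Cairo pentagon: two nonadjacent right angles, three angles `2π/3`, circumscribed about a
circle. -/
def IsCairo (P : Pentagon) : Prop :=
  P.IsCircumscribed ∧ ∃ k : Fin 5,
    P.interiorAngle k = Real.pi / 2 ∧ P.interiorAngle (k + 1) = 2 * Real.pi / 3 ∧
    P.interiorAngle (k + 2) = Real.pi / 2 ∧ P.interiorAngle (k + 3) = 2 * Real.pi / 3 ∧
    P.interiorAngle (k + 4) = 2 * Real.pi / 3

/-- Prismatic pentagon: two adjacent right angles, three angles `2π/3`, circumscribed about a
circle. -/
def IsPrismatic (P : Pentagon) : Prop :=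
  P.IsCircumscribed ∧ ∃ k : Fin 5,
    P.interiorAngle k = Real.pi / 2 ∧ P.interiorAngle (k + 1) = Real.pi / 2 ∧
    P.interiorAngle (k + 2) = 2 * Real.pi / 3 ∧ P.interiorAngle (k + 3) = 2 * Real.pi / 3 ∧
    P.interiorAngle (k + 4) = 2 * Real.pi / 3

/-- A unit-area pentagon is efficient if its perimeter is at most that of a unit-area Cairo
pentagon (the latter is unique up to congruence). -/
def IsEfficient (P : Pentagon) : Prop :=
  P.area = 1 ∧ ∀ Q : Pentagon, Q.IsCairo → Q.area = 1 → P.perimeter ≤ Q.perimeter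

/-- Type 1 non-convex: exactly one interior angle is larger than `π`. -/
def IsType1 (P : Pentagon) : Prop :=
  {k | Real.pi < P.interiorAngle k}.ncard = 1

/-- Type 2 non-convex: exactly two interior angles are larger than `π`. (Their average is then
less than `3π/2`, since the angle sum is `3π`.) -/
def IsType2 (P : Pentagon) : Prop :=
  {k | Real.pi < P.interiorAngle k}.ncard = 2

end Pentagon

/-- An edge-to-edge tiling of the flat torus `ℂ / Λ` by `n` pentagons. Each tile of the torus is
given by one of its lifts to the plane; the lifts of all tiles are the translates `l +ᵥ tile i` with
`l ∈ Λ`, and these have to tile the plane edge-to-edge. -/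
structure TorusTiling (Λ : Submodule ℤ ℂ) (n : ℕ) where
  tile : Fin n → Pentagon
  covers : ∀ z : ℂ, ∃ i, ∃ l ∈ Λ, z ∈ l +ᵥ (tile i).region
  /-- Different lifted tiles do not overlap. -/
  disjoint : ∀ i j, ∀ l ∈ Λ, (i ≠ j ∨ l ≠ 0) →
    Disjoint (tile i).inside (l +ᵥ (tile j).inside)
  /-- Different lifted tiles meet only along entire edges or at vertices. -/
  edge_to_edge : ∀ i j, ∀ l ∈ Λ, (i ≠ j ∨ l ≠ 0) →
    ∀ z ∈ (tile i).region ∩ (l +ᵥ (tile j).region),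
      (∃ k m, z = (tile i).vertex k ∧ z = l + (tile j).vertex m) ∨
      (∃ k m, z ∈ (tile i).edge k ∧ (tile i).edge k = l +ᵥ (tile j).edge m)

namespace TorusTiling

variable {Λ : Submodule ℤ ℂ} {n : ℕ}

/-- Edge `k` of tile `i` and edge `m` of tile `j` are the same edge on the torus if they differ by
a translation in `Λ`. -/
def edgeSetoid (T : TorusTiling Λ n) : Setoid (Fin n × Fin 5) where
  r a b := ∃ l ∈ Λ, (T.tile a.1).edge a.2 = l +ᵥ (T.tile b.1).edge b.2
  iseqv :=
    { refl := fun a => ⟨0, Λ.zero_mem, by simp⟩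
      symm := by
        rintro a b ⟨l, hl, h⟩
        exact ⟨-l, Λ.neg_mem hl, by rw [h, neg_vadd_vadd]⟩
      trans := by
        rintro a b c ⟨l, hl, h⟩ ⟨m, hm, h'⟩
        exact ⟨l + m, Λ.add_mem hl hm, by rw [h, h', vadd_vadd]⟩ }

/-- The edges of the tiling on the torus, each taken once. -/
def Edge (T : TorusTiling Λ n) : Type :=
  Quotient T.edgeSetoid

/-- The length of an edge of the tiling. -/
noncomputable def Edge.length {T : TorusTiling Λ n} (e : T.Edge) : ℝ :=
  Quotient.lift (s := T.edgeSetoid) (fun a => (T.tile a.1).edgeLength a.2)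
    (by
      rintro a b ⟨l, -, h⟩
      show (T.tile a.1).edgeLength a.2 = (T.tile b.1).edgeLength b.2
      rw [← Pentagon.diam_edge, ← Pentagon.diam_edge, h]
      exact diam_vadd l _) e

/-- The perimeter of the tiling: the total length of its edges on the torus, each edge being
counted once. (The sum is finite.) -/
noncomputable def perimeter (T : TorusTiling Λ n) : ℝ :=
  ∑ᶠ e : T.Edge, e.length

/-- The fraction of the tiles that have the property `p`. -/
noncomputable def fraction (T : TorusTiling Λ n) (p : Pentagon → Prop) : ℝ :=
  ({i | p (T.tile i)}.ncard : ℝ) / n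

end TorusTiling

/-! The proposition is an average of one inequality valid for each tile. Let `q` be the perimeter of
the unit-area Prismatic pentagon. For every unit-area pentagon, 2.6·[Type 1] + 13.4·[Type 2] −
[efficient] < (perimeter − q)/0.0518 (`perimeter_sub_gt`). An edge of the torus borders at most two
tiles, so the tile perimeters add up to at most twice the perimeter of the tiling
(`sum_perimeter_le`), hence to at most `n * q`. Summing the tile inequality therefore gives a
negative left side, which is the claim.

The tile inequality rests on four perimeter values for unit area. The regular pentagon gives the
lower bound 2√(5 tan(π/5)) ≈ 3.8119 for all pentagons. A circumscribed pentagon with two right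
angles and three angles 2π/3 has perimeter 2√(2+√3) ≈ 3.8637 wherever the right angles sit, so Cairo
and Prismatic pentagons agree and an inefficient tile has perimeter above `q`. A vertex with angle
larger than π can be cut off without losing area, so Type 1 costs at least the perimeter 4 of the
square. Two such vertices leave a triangle, so Type 2 costs at least 432^(1/4) ≈ 4.559. The gap
between the first two values is about 0.0518. The other two exceed `q` by more than 2.6 and 13.4
times 0.0518.

The isoperimetric inequalities concern signed areas of closed polygons. For five vertices, a
compactness argument reduces to equal sides, where a discrete Wirtinger inequality applies.

Most of the work connects area and interior angles, which are defined through Lebesgue measure and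
bounded components, with cross products. This needs the Jordan curve theorem for pentagons
(`exists_orientation`), proved with winding numbers. It yields the shoelace formula (`area_eq`), by
integrating the winding number, and the relation between the angle at a vertex and the sign of the
turn there. -/

open Filter MeasureTheory

/-! ### Cross products; isoperimetric inequalities for triangles and quadrilaterals -/

/-- The cross product of two vectors of the plane. -/
def cross (x y : ℂ) : ℝ := x.re * y.im - x.im * y.re

theorem cross_add_right (x y z : ℂ) : cross x (y + z) = cross x y + cross x z := by
  simp [cross]; ring

theorem cross_sub_right (x y z : ℂ) : cross x (y - z) = cross x y - cross x z := by
  simp [cross]; ring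

theorem cross_mul_left (s : ℝ) (x y : ℂ) : cross (s * x) y = s * cross x y := by
  simp [cross]; ring

theorem cross_mul_right (s : ℝ) (x y : ℂ) : cross x (s * y) = s * cross x y := by
  simp [cross]; ring

theorem cross_self_right (x : ℂ) : cross x x = 0 := by
  simp [cross]; ring

theorem cross_swap (x y : ℂ) : cross y x = -cross x y := by
  simp [cross]; ring

theorem norm_sq_eq (z : ℂ) : ‖z‖ ^ 2 = z.re ^ 2 + z.im ^ 2 := by
  rw [Complex.sq_norm, Complex.normSq_apply]; ring

theorem cross_sq_add_dot_sq (x y : ℂ) :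
    cross x y ^ 2 + (x.re * y.re + x.im * y.im) ^ 2 = ‖x‖ ^ 2 * ‖y‖ ^ 2 := by
  rw [norm_sq_eq, norm_sq_eq, cross]; ring

theorem dot_le_norm_mul_norm (x y : ℂ) : x.re * y.re + x.im * y.im ≤ ‖x‖ * ‖y‖ := by
  apply le_of_sq_le_sq _ (by positivity)
  nlinarith [cross_sq_add_dot_sq x y, sq_nonneg (cross x y)]

/-- Among the triangles with two given vertices and given sum of the lengths of the other two
sides, the isosceles one has the largest area. -/
theorem four_mul_cross_sq_le (x y : ℂ) :
    4 * cross x y ^ 2 ≤ ‖x + y‖ ^ 2 * ((‖x‖ + ‖y‖) ^ 2 - ‖x + y‖ ^ 2) := by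
  have h1 := cross_sq_add_dot_sq x y
  have h2 := dot_le_norm_mul_norm x y
  have h3 : ‖x + y‖ ^ 2 = ‖x‖ ^ 2 + ‖y‖ ^ 2 + 2 * (x.re * y.re + x.im * y.im) := by
    simp only [norm_sq_eq, Complex.add_re, Complex.add_im]; ring
  set d := x.re * y.re + x.im * y.im
  have h4 : 2 * (‖x‖ * ‖y‖ + d) ≤ ‖x + y‖ ^ 2 := by
    nlinarith [sq_nonneg (‖x‖ - ‖y‖)]
  have h5 : (‖x‖ + ‖y‖) ^ 2 - ‖x + y‖ ^ 2 = 2 * (‖x‖ * ‖y‖ - d) := by rw [h3]; ring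
  rw [h5]
  nlinarith [mul_le_mul_of_nonneg_right h4 (show 0 ≤ 2 * (‖x‖ * ‖y‖ - d) by linarith)]

theorem two_mul_cross_le (x y : ℂ) :
    2 * cross x y ≤ ‖x + y‖ * √((‖x‖ + ‖y‖) ^ 2 - ‖x + y‖ ^ 2) := by
  have h0 : 0 ≤ (‖x‖ + ‖y‖) ^ 2 - ‖x + y‖ ^ 2 := by
    have := norm_add_le x y
    have := norm_nonneg (x + y)
    nlinarith
  apply le_of_sq_le_sq _ (by positivity)
  rw [mul_pow, mul_pow, Real.sq_sqrt h0]
  nlinarith [four_mul_cross_sq_le x y]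

/-- The isoperimetric inequality for triangles. -/
theorem triangle_isoperimetric (x y : ℂ) :
    432 * (cross x y / 2) ^ 2 ≤ (‖x‖ + ‖y‖ + ‖x + y‖) ^ 4 := by
  have h := four_mul_cross_sq_le x y
  have hd := norm_nonneg (x + y)
  have hs := norm_add_le x y
  set d := ‖x + y‖
  set s := ‖x‖ + ‖y‖
  -- AM–GM for the three numbers `d`, `d`, `s - d`, whose sum is the perimeter.
  have key : 27 * (d ^ 2 * (s - d)) ≤ (s + d) ^ 3 := by
    nlinarith [mul_nonneg (show 0 ≤ 4 * d + s by linarith) (sq_nonneg (s - 2 * d)),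
      mul_nonneg hd (sq_nonneg (s - 2 * d))]
  have : 27 * (d ^ 2 * (s - d)) * (s + d) ≤ (s + d) ^ 3 * (s + d) :=
    mul_le_mul_of_nonneg_right key (by linarith)
  nlinarith

/-- The isoperimetric inequality for quadrilaterals, with edge vectors `a`, `b`, `c`, `d`. -/
theorem quadrilateral_isoperimetric (a b c d : ℂ) (h : a + b + c + d = 0) :
    16 * ((cross a b + cross c d) / 2) ≤ (‖a‖ + ‖b‖ + ‖c‖ + ‖d‖) ^ 2 := by
  have h1 := two_mul_cross_le a b
  have h2 := two_mul_cross_le c d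
  have e : ‖c + d‖ = ‖a + b‖ := by
    rw [show c + d = -(a + b) by linear_combination h, norm_neg]
  rw [e] at h2
  have hs := norm_add_le a b
  have ht := norm_add_le c d
  rw [e] at ht
  have hD := norm_nonneg (a + b)
  set D := ‖a + b‖
  set s := ‖a‖ + ‖b‖
  set t := ‖c‖ + ‖d‖
  have bound : ∀ s, D ≤ s → ∀ k, 2 * (k * D) * √(s ^ 2 - D ^ 2) ≤ k ^ 2 * D ^ 2 + (s ^ 2 - D ^ 2)
      := by
    intro s hs k
    have := Real.sq_sqrt (show 0 ≤ s ^ 2 - D ^ 2 by nlinarith)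
    nlinarith [sq_nonneg (k * D - √(s ^ 2 - D ^ 2))]
  have q1 := Real.sq_sqrt (show 0 ≤ s ^ 2 - D ^ 2 by nlinarith)
  have q2 := Real.sq_sqrt (show 0 ≤ t ^ 2 - D ^ 2 by nlinarith)
  have p1 := Real.sqrt_nonneg (s ^ 2 - D ^ 2)
  have p2 := Real.sqrt_nonneg (t ^ 2 - D ^ 2)
  set u := √(s ^ 2 - D ^ 2)
  set v := √(t ^ 2 - D ^ 2)
  -- Cauchy–Schwarz for the vectors (D, u) and (D, v) of lengths `s` and `t`. It gives (s + t)² ≥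
  -- (2D)² + (u + v)² ≥ 4D(u + v).
  have hst : D ^ 2 + u * v ≤ s * t := by
    apply le_of_sq_le_sq _ (by nlinarith)
    have : (s * t) ^ 2 = (u ^ 2 + D ^ 2) * (v ^ 2 + D ^ 2) := by rw [q1, q2]; ring
    rw [this]
    nlinarith [sq_nonneg (D * (u - v))]
  have : ‖a‖ + ‖b‖ + ‖c‖ + ‖d‖ = s + t := by simp only [s, t]; ring
  rw [this]
  nlinarith [sq_nonneg (2 * D - (u + v))]

/-! ### The isoperimetric inequality for pentagons -/

/-- The signed area of a closed polygon with five vertices. -/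
noncomputable def signedArea (v : Fin 5 → ℂ) : ℝ := (∑ k, cross (v k) (v (k + 1))) / 2

theorem signedArea_eq (v : Fin 5 → ℂ) : signedArea v = (cross (v 0) (v 1) + cross (v 1) (v 2) +
    cross (v 2) (v 3) + cross (v 3) (v 4) + cross (v 4) (v 0)) / 2 := by
  rw [signedArea, Fin.sum_univ_five]; rfl

/-- The real form of the discrete Wirtinger inequality for five points. -/
theorem wirtinger_five_real {s : ℝ} (hs : s ^ 2 = 5) (hs0 : 0 < s) (a b c d e : ℝ)
    (h : a + b + c + d + e = 0) :
    4 * (a * b + b * c + c * d + d * e + e * a) ≤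
      (s - 1) * (a ^ 2 + b ^ 2 + c ^ 2 + d ^ 2 + e ^ 2) := by
  -- Since s − 1 = 4 cos(2π/5), the inequality is an equality on the first Fourier modes. On
  -- mean-zero vectors the slack is a combination of the squares of the two components of frequency
  -- 2, which are the two squares below.
  have key : s * (5 - s) / 32 * ((s - 1) * (a ^ 2 + b ^ 2 + c ^ 2 + d ^ 2 + e ^ 2) -
      4 * (a * b + b * c + c * d + d * e + e * a)) =
      (5 - s) / 8 * (a - (1 + s) / 4 * (b + e) + (s - 1) / 4 * (c + d)) ^ 2 +
      ((5 - s) / 8 * (b - e) - s / 4 * (c - d)) ^ 2 := by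
    obtain rfl : e = -(a + b + c + d) := by linarith
    grind
  have hs5 : s < 5 := by nlinarith
  have h1 : 0 < s * (5 - s) / 32 := by
    have : 0 < 5 - s := by linarith
    positivity
  have h2 : 0 ≤ (5 - s) / 8 * (a - (1 + s) / 4 * (b + e) + (s - 1) / 4 * (c + d)) ^ 2 +
      ((5 - s) / 8 * (b - e) - s / 4 * (c - d)) ^ 2 := by
    have : 0 ≤ (5 - s) / 8 := by linarith
    positivity
  rw [← key] at h2
  linarith [nonneg_of_mul_nonneg_right h2 h1]

/-- The polygonal Wirtinger inequality for pentagons; note that `tan (π / 5) ^ 2 = 5 - 2 * √5`. -/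
theorem wirtinger_five {T : ℝ} (hT : T ^ 2 = 5 - 2 * √5) (hT0 : 0 < T) (v : Fin 5 → ℂ) :
    4 * T * signedArea v ≤ ‖v 1 - v 0‖ ^ 2 + ‖v 2 - v 1‖ ^ 2 + ‖v 3 - v 2‖ ^ 2 +
      ‖v 4 - v 3‖ ^ 2 + ‖v 0 - v 4‖ ^ 2 := by
  have hs : √5 ^ 2 = (5 : ℝ) := Real.sq_sqrt (by norm_num)
  have hs0 : 0 < √(5 : ℝ) := by positivity
  generalize √(5 : ℝ) = s at *
  -- Only the abscissas need mean zero; the ordinates enter through differences.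
  obtain ⟨m, hm⟩ : ∃ m, m = ((v 0).re + (v 1).re + (v 2).re + (v 3).re + (v 4).re) / 5 := ⟨_, rfl⟩
  have key := wirtinger_five_real hs hs0 ((v 0).re - m) ((v 1).re - m) ((v 2).re - m)
    ((v 3).re - m) ((v 4).re - m) (by rw [hm]; ring)
  rw [signedArea_eq]
  simp only [norm_sq_eq, cross, Complex.sub_re, Complex.sub_im]
  have e : ∀ i, (v i).re = (v i).re - m + m := fun i => by ring
  have hs5 : s < 5 / 2 := by nlinarith
  generalize hx0 : (v 0).re - m = x0 at *
  generalize hx1 : (v 1).re - m = x1 at *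
  generalize hx2 : (v 2).re - m = x2 at *
  generalize hx3 : (v 3).re - m = x3 at *
  generalize hx4 : (v 4).re - m = x4 at *
  rw [e 0, e 1, e 2, e 3, e 4, hx0, hx1, hx2, hx3, hx4]
  generalize (v 0).im = y0
  generalize (v 1).im = y1
  generalize (v 2).im = y2
  generalize (v 3).im = y3
  generalize (v 4).im = y4
  -- By the trapezoid formula, Σ (x_k + x_{k+1})(y_{k+1} − y_k) is twice the signed area, so the
  -- cross terms of these squares add up to −4T times the signed area. What remains is an inequality
  -- in the abscissas alone.
  have sq := add_nonneg (add_nonneg (add_nonneg (add_nonneg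
    (sq_nonneg (y1 - y0 - T * (x0 + x1))) (sq_nonneg (y2 - y1 - T * (x1 + x2))))
    (sq_nonneg (y3 - y2 - T * (x2 + x3)))) (sq_nonneg (y4 - y3 - T * (x3 + x4))))
    (sq_nonneg (y0 - y4 - T * (x4 + x0)))
  have final : T ^ 2 * ((x0 + x1) ^ 2 + (x1 + x2) ^ 2 + (x2 + x3) ^ 2 + (x3 + x4) ^ 2 +
      (x4 + x0) ^ 2) ≤ (x1 - x0) ^ 2 + (x2 - x1) ^ 2 + (x3 - x2) ^ 2 + (x4 - x3) ^ 2 +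
      (x0 - x4) ^ 2 := by
    rw [hT]
    have := mul_le_mul_of_nonneg_left key (show 0 ≤ (6 - 2 * s) by linarith)
    have h5 : (6 - 2 * s) * (s - 1) = 8 * s - 16 := by linear_combination -2 * hs
    rw [← mul_assoc (6 - 2 * s) (s - 1), h5] at this
    linarith
  linarith

/-- The symmetrization step: with base and total side length fixed, the isosceles apex maximizes the
area. It lets two neighbouring sides of a polygon be equalized. -/
theorem exists_isosceles (a b v : ℂ) : ∃ w : ℂ, ‖w - a‖ = (‖v - a‖ + ‖b - v‖) / 2 ∧
    ‖b - w‖ = (‖v - a‖ + ‖b - v‖) / 2 ∧ cross (v - a) (b - v) ≤ cross (w - a) (b - w) := by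
  have hx := two_mul_cross_le (v - a) (b - v)
  have ht := norm_add_le (v - a) (b - v)
  have e : v - a + (b - v) = b - a := by ring
  rw [e] at hx ht
  obtain ⟨u, hu, hd⟩ : ∃ u : ℂ, ‖u‖ = 1 ∧ b - a = ‖b - a‖ * u := by
    by_cases h : b - a = 0
    · exact ⟨1, by simp, by simp [h]⟩
    · have : (‖b - a‖ : ℂ) ≠ 0 := by simpa using h
      exact ⟨(b - a) / ‖b - a‖, by simp [h], by field_simp⟩
  have hd0 := norm_nonneg (b - a)
  generalize hdd : ‖b - a‖ = d at *
  generalize hss : ‖v - a‖ + ‖b - v‖ = s at *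
  have hsq : 0 ≤ s ^ 2 - d ^ 2 := by nlinarith
  have hu2 : u.re ^ 2 + u.im ^ 2 = 1 := by rw [← norm_sq_eq, hu]; norm_num
  have hq := Real.sq_sqrt hsq
  have hs0 : 0 ≤ s / 2 := by rw [← hss]; positivity
  generalize √(s ^ 2 - d ^ 2) = h at *
  obtain rfl : b = a + d * u := by rw [← hd]; ring
  have hn : ∀ z : ℂ, z.re ^ 2 + z.im ^ 2 = (s / 2) ^ 2 → ‖z‖ = s / 2 := fun z hz => by
    rw [← norm_sq_eq] at hz
    exact (sq_eq_sq₀ (norm_nonneg _) hs0).1 hz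
  -- The apex over the midpoint at height `h / 2`; the minus sign selects the side on which the
  -- cross product is +d·h/2.
  refine ⟨a + (((d / 2 : ℝ) : ℂ) - ((h / 2 : ℝ) : ℂ) * Complex.I) * u, hn _ ?_, hn _ ?_, ?_⟩
  · simp
    linear_combination (d ^ 2 + h ^ 2) / 4 * hu2 + hq / 4
  · simp
    linear_combination (d ^ 2 + h ^ 2) / 4 * hu2 + hq / 4
  · have : cross (a + (((d / 2 : ℝ) : ℂ) - ((h / 2 : ℝ) : ℂ) * Complex.I) * u - a)
        (a + d * u - (a + (((d / 2 : ℝ) : ℂ) - ((h / 2 : ℝ) : ℂ) * Complex.I) * u)) = d * h / 2 :=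
            by
      simp [cross]
      linear_combination (d * h / 2) * hu2
    rw [this]
    linarith

/-- The perimeter of a closed polygon with five vertices. -/
noncomputable def closedLength (v : Fin 5 → ℂ) : ℝ := ‖v 1 - v 0‖ + ‖v 2 - v 1‖ + ‖v 3 - v 2‖ +
  ‖v 4 - v 3‖ + ‖v 0 - v 4‖

/-- The sum of the squares of the edge lengths of a closed polygon with five vertices. -/
noncomputable def closedEnergy (v : Fin 5 → ℂ) : ℝ := ‖v 1 - v 0‖ ^ 2 + ‖v 2 - v 1‖ ^ 2 +
  ‖v 3 - v 2‖ ^ 2 + ‖v 4 - v 3‖ ^ 2 + ‖v 0 - v 4‖ ^ 2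

theorem signedArea_sub_const (v : Fin 5 → ℂ) (c : ℂ) :
    signedArea (fun k => v k - c) = signedArea v := by
  simp only [signedArea_eq, cross, Complex.sub_re, Complex.sub_im]; ring

theorem continuous_cross {f g : (Fin 5 → ℂ) → ℂ} (hf : Continuous f) (hg : Continuous g) :
    Continuous fun v => cross (f v) (g v) := by
  unfold cross
  fun_prop

theorem continuous_signedArea : Continuous signedArea := by
  have : signedArea = fun v => signedArea v := rfl
  rw [this]
  simp only [signedArea_eq]
  have h (i : Fin 5) : Continuous fun v : Fin 5 → ℂ => v i := continuous_apply i
  exact (((((continuous_cross (h _) (h _)).add (continuous_cross (h _) (h _))).add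
    (continuous_cross (h _) (h _))).add (continuous_cross (h _) (h _))).add
    (continuous_cross (h _) (h _))).div_const _

theorem continuous_closedLength : Continuous closedLength := by
  unfold closedLength; fun_prop

theorem continuous_closedEnergy : Continuous closedEnergy := by
  unfold closedEnergy; fun_prop

/-- Pinning vertex 0 removes the translations, and the length bound then confines all vertices to a
ball. -/
theorem isCompact_polygons (A p : ℝ) :
    IsCompact {v : Fin 5 → ℂ | v 0 = 0 ∧ closedLength v ≤ p ∧ A ≤ signedArea v} := by
  apply Metric.isCompact_of_isClosed_isBounded
  · exact (isClosed_eq (continuous_apply 0) continuous_const).inter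
      ((isClosed_le continuous_closedLength continuous_const).inter
      (isClosed_le continuous_const continuous_signedArea))
  · refine (Metric.isBounded_closedBall (x := (0 : Fin 5 → ℂ)) (r := p)).subset ?_
    rintro v ⟨h0, hp, -⟩
    unfold closedLength at hp
    have n1 := norm_nonneg (v 1 - v 0)
    have n2 := norm_nonneg (v 2 - v 1)
    have n3 := norm_nonneg (v 3 - v 2)
    have n4 := norm_nonneg (v 4 - v 3)
    have n5 := norm_nonneg (v 0 - v 4)
    have t2 := norm_add_le (v 2 - v 1) (v 1 - v 0)
    have t3 := norm_add_le (v 3 - v 2) (v 2 - v 0)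
    have t4 := norm_add_le (v 4 - v 3) (v 3 - v 0)
    simp only [sub_add_sub_cancel] at t2 t3 t4
    simp only [h0, sub_zero] at hp n1 t2 t3 t4 n5
    rw [mem_closedBall_zero_iff, pi_norm_le_iff_of_nonneg (by linarith)]
    intro i
    fin_cases i <;> simp only [Fin.reduceFinMk, Fin.zero_eta, Fin.isValue, Fin.mk_one, h0,
        norm_zero] <;> linarith

/-- The isoperimetric inequality for closed polygons with five vertices. -/
theorem pentagon_isoperimetric {T : ℝ} (hT : T ^ 2 = 5 - 2 * √5) (hT0 : 0 < T) (v : Fin 5 → ℂ) :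
    20 * T * signedArea v ≤ closedLength v ^ 2 := by
  -- Energy, not length, is minimized, under bounds on length and area. If two consecutive sides at
  -- vertex 1, 2, 3 or 4 differed, the isosceles replacement would keep the length, not decrease the
  -- area and strictly lower the energy. These four vertices suffice to make all five sides equal,
  -- and vertex 0 stays pinned.
  obtain ⟨w, ⟨hw0, hwp, hwA⟩, hmin⟩ := (isCompact_polygons (signedArea v)
      (closedLength v)).exists_isMinOn
    ⟨fun k => v k - v 0, by simp, by simp [closedLength], (signedArea_sub_const v _).ge⟩
    continuous_closedEnergy.continuousOn
  have h1 : ‖w 1 - w 0‖ = ‖w 2 - w 1‖ := by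
    obtain ⟨u, hu1, hu2, hu3⟩ := exists_isosceles (w 0) (w 2) (w 1)
    have := hmin (show Function.update w 1 u ∈ _ from ⟨by simpa using hw0, by
      simp [closedLength, hu1, hu2] at hwp ⊢; linarith, by
      simp [signedArea_eq, cross] at hwA hu3 ⊢; linarith⟩)
    simp [closedEnergy, hu1, hu2] at this
    nlinarith [sq_nonneg (‖w 1 - w 0‖ - ‖w 2 - w 1‖)]
  have h2 : ‖w 2 - w 1‖ = ‖w 3 - w 2‖ := by
    obtain ⟨u, hu1, hu2, hu3⟩ := exists_isosceles (w 1) (w 3) (w 2)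
    have := hmin (show Function.update w 2 u ∈ _ from ⟨by simpa using hw0, by
      simp [closedLength, hu1, hu2] at hwp ⊢; linarith, by
      simp [signedArea_eq, cross] at hwA hu3 ⊢; linarith⟩)
    simp [closedEnergy, hu1, hu2] at this
    nlinarith [sq_nonneg (‖w 2 - w 1‖ - ‖w 3 - w 2‖)]
  have h3 : ‖w 3 - w 2‖ = ‖w 4 - w 3‖ := by
    obtain ⟨u, hu1, hu2, hu3⟩ := exists_isosceles (w 2) (w 4) (w 3)
    have := hmin (show Function.update w 3 u ∈ _ from ⟨by simpa using hw0, by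
      simp [closedLength, hu1, hu2] at hwp ⊢; linarith, by
      simp [signedArea_eq, cross] at hwA hu3 ⊢; linarith⟩)
    simp [closedEnergy, hu1, hu2] at this
    nlinarith [sq_nonneg (‖w 3 - w 2‖ - ‖w 4 - w 3‖)]
  have h4 : ‖w 4 - w 3‖ = ‖w 0 - w 4‖ := by
    obtain ⟨u, hu1, hu2, hu3⟩ := exists_isosceles (w 3) (w 0) (w 4)
    have := hmin (show Function.update w 4 u ∈ _ from ⟨by simpa using hw0, by
      simp [closedLength, hu1, hu2] at hwp ⊢; linarith, by
      simp [signedArea_eq, cross] at hwA hu3 ⊢; linarith⟩)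
    simp [closedEnergy, hu1, hu2] at this
    nlinarith [sq_nonneg (‖w 4 - w 3‖ - ‖w 0 - w 4‖)]
  have hW := wirtinger_five hT hT0 w
  have hL : closedLength w = 5 * ‖w 0 - w 4‖ := by
    rw [closedLength, h1, h2, h3, h4]; ring
  rw [h1, h2, h3, h4] at hW
  have hn := norm_nonneg (w 0 - w 4)
  nlinarith [mul_le_mul_of_nonneg_left hwA hT0.le]

/-! ### Angles subtended by segments -/

/-- The signed angle under which the segment from `a` to `b` is seen from `z`. -/
noncomputable def turn (a b z : ℂ) : ℝ := Complex.arg ((b - z) / (a - z))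

/-- A quotient `-s` with `s ≥ 0` would put `z` on the segment at parameter 1/(1+s). Hence off the
segment the argument stays away from its branch cut, and `turn` is continuous there with values
strictly between −π and π. -/
theorem div_mem_slitPlane_of_notMem_segment {a b z : ℂ} (hz : z ∉ segment ℝ a b) :
    (b - z) / (a - z) ∈ Complex.slitPlane := by
  have ha : a - z ≠ 0 := fun h => hz (by rw [← sub_eq_zero.1 h]; exact left_mem_segment ℝ a b)
  by_contra h
  rw [Complex.mem_slitPlane_iff] at h
  push Not at h
  obtain ⟨h1, h2⟩ := h
  set s := -((b - z) / (a - z)).re with hs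
  have hs0 : 0 ≤ s := by linarith
  have e : (b - z) / (a - z) = ((-s : ℝ) : ℂ) := by
    apply Complex.ext <;> simp [h2, hs]
  rw [div_eq_iff ha] at e
  apply hz
  rw [segment_eq_image_lineMap]
  refine ⟨1 / (1 + s), ⟨by positivity, by rw [div_le_one (by linarith)]; linarith⟩, ?_⟩
  have hs1 : (1 + (s : ℂ)) ≠ 0 := by
    exact_mod_cast (show (1 + s) ≠ 0 by linarith)
  rw [AffineMap.lineMap_apply_module']
  simp only [Complex.real_smul]
  push_cast at e ⊢
  field_simp
  linear_combination e

theorem continuousAt_turn {a b z : ℂ} (hz : z ∉ segment ℝ a b) : ContinuousAt (turn a b) z := by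
  have ha : a - z ≠ 0 := fun h => hz (by rw [← sub_eq_zero.1 h]; exact left_mem_segment ℝ a b)
  have h := Complex.continuousAt_arg (div_mem_slitPlane_of_notMem_segment hz)
  have h' : ContinuousAt (fun z => (b - z) / (a - z)) z := by fun_prop (disch := assumption)
  exact ContinuousAt.comp (f := fun z => (b - z) / (a - z)) h h'

theorem measurable_turn (a b : ℂ) : Measurable (turn a b) := by
  unfold turn
  fun_prop

theorem turn_swap {a b z : ℂ} (hz : z ∉ segment ℝ a b) : turn b a z = -turn a b z := by
  have := div_mem_slitPlane_of_notMem_segment hz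
  rw [turn, turn, ← inv_div, Complex.arg_inv, if_neg (Complex.mem_slitPlane_iff_arg.1 this).1]

theorem im_div_eq_cross (a b z : ℂ) :
    ((b - z) / (a - z)).im = cross (a - z) (b - z) / Complex.normSq (a - z) := by
  rw [Complex.div_im, cross]; ring

theorem turn_pos_iff {a b z : ℂ} (ha : cross (a - z) (b - z) ≠ 0) :
    0 < turn a b z ↔ 0 < cross (a - z) (b - z) := by
  have h0 : 0 < Complex.normSq (a - z) := by
    rw [Complex.normSq_pos]
    rintro h
    simp [h, cross] at ha
  have : turn a b z ≠ 0 := by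
    intro h
    rw [turn, Complex.arg_eq_zero_iff, im_div_eq_cross] at h
    exact ha (by simpa [h0.ne'] using h.2)
  rw [lt_iff_le_and_ne, and_iff_left this.symm, turn, Complex.arg_nonneg_iff, im_div_eq_cross,
    le_div_iff₀ h0, zero_mul]
  exact ⟨fun h => lt_of_le_of_ne h ha.symm, le_of_lt⟩

theorem abs_turn_lt {a b z : ℂ} (hz : z ∉ segment ℝ a b) : |turn a b z| < Real.pi := by
  have := div_mem_slitPlane_of_notMem_segment hz
  exact lt_of_le_of_ne (Complex.abs_arg_le_pi _) fun h => by
    rcases abs_eq Real.pi_nonneg |>.1 h with h | h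
    · exact (Complex.mem_slitPlane_iff_arg.1 this).1 h
    · exact (Complex.neg_pi_lt_arg _).ne' h

/-- The exponential of `I` times the sum is the product of the factors divided by their norms, which
is 1. This is why winding numbers are integers. -/
theorem exists_int_sum_arg {ι : Type*} (s : Finset ι) (f : ι → ℂ) (h : ∏ i ∈ s, f i = 1) :
    ∃ m : ℤ, ∑ i ∈ s, Complex.arg (f i) = m * (2 * Real.pi) := by
  have h1 : Complex.exp ((∑ i ∈ s, Complex.arg (f i) : ℝ) * Complex.I) = 1 := by
    have h2 : ∏ i ∈ s, ‖f i‖ = 1 := by rw [← norm_prod, h, norm_one]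
    push_cast
    rw [Finset.sum_mul, Complex.exp_sum]
    calc _ = ((∏ i ∈ s, ‖f i‖ : ℝ) : ℂ) * ∏ i ∈ s, Complex.exp (Complex.arg (f i) * Complex.I) := by
          rw [h2]; simp
      _ = ∏ i ∈ s, f i := by
          rw [Complex.ofReal_prod, ← Finset.prod_mul_distrib]
          exact Finset.prod_congr rfl fun i _ => Complex.norm_mul_exp_arg_mul_I _
      _ = 1 := h
  obtain ⟨m, hm⟩ := Complex.exp_eq_one_iff.1 h1
  refine ⟨m, ?_⟩
  have hm' : ((∑ i ∈ s, Complex.arg (f i) : ℝ) : ℂ) = ((m * (2 * Real.pi) : ℝ) : ℂ) := by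
    apply mul_right_cancel₀ Complex.I_ne_zero
    rw [hm]; push_cast; ring
  exact_mod_cast hm'

/-- The closed triangle, seen from a point in general position. -/
theorem sum_turn_triangle {a b c z : ℂ} (hab : cross (a - z) (b - z) ≠ 0)
    (hbc : cross (b - z) (c - z) ≠ 0) (hca : cross (c - z) (a - z) ≠ 0)
    (h1 : z ∉ segment ℝ a b) (h2 : z ∉ segment ℝ b c) (h3 : z ∉ segment ℝ c a)
    (hpos : 0 ≤ cross (b - a) (c - a)) :
    turn a b z + turn b c z + turn c a z =
      if 0 < cross (a - z) (b - z) ∧ 0 < cross (b - z) (c - z) ∧ 0 < cross (c - z) (a - z)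
      then 2 * Real.pi else 0 := by
  obtain ⟨m, hm⟩ := exists_int_sum_arg Finset.univ
    ![(b - z) / (a - z), (c - z) / (b - z), (a - z) / (c - z)] (by
      have ha : a - z ≠ 0 := by rintro h; simp [h, cross] at hab
      have hb : b - z ≠ 0 := by rintro h; simp [h, cross] at hab
      have hc : c - z ≠ 0 := by rintro h; simp [h, cross] at hbc
      simp [Fin.prod_univ_three]
      field_simp)
  have hm' : turn a b z + turn b c z + turn c a z = m * (2 * Real.pi) := by
    rw [← hm, Fin.sum_univ_three]; rfl
  have hsum : cross (a - z) (b - z) + cross (b - z) (c - z) + cross (c - z) (a - z) =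
      cross (b - a) (c - a) := by
    simp only [cross, Complex.sub_re, Complex.sub_im]; ring
  have p1 := turn_pos_iff hab
  have p2 := turn_pos_iff hbc
  have p3 := turn_pos_iff hca
  have q1 := abs_lt.1 (abs_turn_lt h1)
  have q2 := abs_lt.1 (abs_turn_lt h2)
  have q3 := abs_lt.1 (abs_turn_lt h3)
  have hpi := Real.pi_pos
  split_ifs with h
  · have r1 := p1.2 h.1
    have r2 := p2.2 h.2.1
    have r3 := p3.2 h.2.2
    have m1 : 0 < m := by
      have : (0 : ℝ) < m := by
        by_contra hm0
        nlinarith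
      exact_mod_cast this
    have m2 : m < 2 := by
      have : (m : ℝ) < 2 := by
        by_contra hm0
        nlinarith
      exact_mod_cast this
    obtain rfl : m = 1 := by omega
    rw [hm']; simp
  · have hneg : ¬ (cross (a - z) (b - z) < 0 ∧ cross (b - z) (c - z) < 0 ∧
        cross (c - z) (a - z) < 0) := fun ⟨_, _, _⟩ => by linarith
    have lower : -(2 * Real.pi) < turn a b z + turn b c z + turn c a z := by
      rcases hab.lt_or_gt with h1 | h1
      · rcases hbc.lt_or_gt with h2 | h2
        · have := p3.2 (lt_of_le_of_ne (not_lt.1 fun h3 => hneg ⟨h1, h2, h3⟩) hca.symm)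
          linarith
        · have := p2.2 h2
          linarith
      · have := p1.2 h1
        linarith
    have upper : turn a b z + turn b c z + turn c a z < 2 * Real.pi := by
      by_cases h1 : 0 < cross (a - z) (b - z)
      · by_cases h2 : 0 < cross (b - z) (c - z)
        · have := mt p3.1 fun h3 => h ⟨h1, h2, h3⟩
          linarith
        · have := mt p2.1 h2
          linarith
      · have := mt p1.1 h1
        linarith
    have m1 : -1 < m := by
      have : (-1 : ℝ) < m := by
        by_contra hm0
        nlinarith
      exact_mod_cast this
    have m2 : m < 1 := by
      have : (m : ℝ) < 1 := by
        by_contra hm0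
        nlinarith
      exact_mod_cast this
    obtain rfl : m = 0 := by omega
    rw [hm']; simp

theorem div_eq_of_near_edge {a b : ℂ} (hab : a ≠ b) {s : ℝ} (hs0 : 0 < s) (t : ℝ) :
    (b - (a + s * (b - a) + t * (Complex.I * (b - a)))) /
      (a - (a + s * (b - a) + t * (Complex.I * (b - a)))) =
      ((1 - s : ℝ) - t * Complex.I) / ((-s : ℝ) - t * Complex.I) := by
  have h1 : b - a ≠ 0 := sub_ne_zero.2 hab.symm
  have h2 : ((-s : ℝ) - t * Complex.I : ℂ) ≠ 0 := by
    intro h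
    have := congrArg Complex.re h
    simp at this
    linarith
  rw [show a - (a + s * (b - a) + t * (Complex.I * (b - a))) =
    ((-s : ℝ) - t * Complex.I) * (b - a) by push_cast; ring,
    show b - (a + s * (b - a) + t * (Complex.I * (b - a))) =
    ((1 - s : ℝ) - t * Complex.I) * (b - a) by push_cast; ring, mul_div_mul_right _ _ h1]

theorem im_near_edge {s : ℝ} (t : ℝ) :
    (((1 - s : ℝ) - t * Complex.I : ℂ) / ((-s : ℝ) - t * Complex.I)).im = t / (s ^ 2 + t ^ 2) := by
  rw [Complex.div_im]
  simp [Complex.normSq_apply]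
  ring

theorem tendsto_near_edge {s : ℝ} (hs0 : 0 < s) :
    Tendsto (fun t : ℝ => ((1 - s : ℝ) - t * Complex.I : ℂ) / ((-s : ℝ) - t * Complex.I)) (𝓝 0)
      (𝓝 ((-((1 - s) / s) : ℝ) : ℂ)) := by
  have h : ((-s : ℝ) - (0 : ℝ) * Complex.I : ℂ) ≠ 0 := by
    simpa using hs0.ne'
  have : ContinuousAt (fun t : ℝ => ((1 - s : ℝ) - t * Complex.I : ℂ) / ((-s : ℝ) - t * Complex.I))
      0 := by
    fun_prop (disch := assumption)
  convert this.tendsto using 2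
  simp
  field_simp

/-- The quotient tends to the negative number −(1 − s)/s from the upper half-plane, where the
argument tends to π. From the right of the edge the approach is from below, and the limit is −π. -/
theorem tendsto_turn_left {a b : ℂ} (hab : a ≠ b) {s : ℝ} (hs0 : 0 < s) (hs1 : s < 1) :
    Tendsto (fun t : ℝ => turn a b (a + s * (b - a) + t * (Complex.I * (b - a)))) (𝓝[>] 0)
      (𝓝 Real.pi) := by
  have hneg : -((1 - s) / s) < 0 := by
    have : 0 < (1 - s) / s := div_pos (by linarith) hs0
    linarith
  have h := Complex.tendsto_arg_nhdsWithin_im_nonneg_of_re_neg_of_im_zero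
    (z := ((-((1 - s) / s) : ℝ) : ℂ)) (by simpa only [Complex.ofReal_re] using hneg)
        (Complex.ofReal_im _)
  refine (h.comp (tendsto_nhdsWithin_iff.2
    ⟨(tendsto_near_edge hs0).mono_left nhdsWithin_le_nhds, ?_⟩)).congr fun t => ?_
  · filter_upwards [self_mem_nhdsWithin] with t ht
    have ht : 0 < t := ht
    show 0 ≤ Complex.im _
    rw [im_near_edge]
    positivity
  · rw [turn, div_eq_of_near_edge hab hs0]; rfl

theorem tendsto_turn_right {a b : ℂ} (hab : a ≠ b) {s : ℝ} (hs0 : 0 < s) (hs1 : s < 1) :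
    Tendsto (fun t : ℝ => turn a b (a + s * (b - a) + t * (Complex.I * (b - a)))) (𝓝[<] 0)
      (𝓝 (-Real.pi)) := by
  have hneg : -((1 - s) / s) < 0 := by
    have : 0 < (1 - s) / s := div_pos (by linarith) hs0
    linarith
  have h := Complex.tendsto_arg_nhdsWithin_im_neg_of_re_neg_of_im_zero
    (z := ((-((1 - s) / s) : ℝ) : ℂ)) (by simpa only [Complex.ofReal_re] using hneg)
        (Complex.ofReal_im _)
  refine (h.comp (tendsto_nhdsWithin_iff.2
    ⟨(tendsto_near_edge hs0).mono_left nhdsWithin_le_nhds, ?_⟩)).congr fun t => ?_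
  · filter_upwards [self_mem_nhdsWithin] with t ht
    have ht : t < 0 := ht
    show Complex.im _ < 0
    rw [im_near_edge]
    exact div_neg_of_neg_of_pos ht (by positivity)
  · rw [turn, div_eq_of_near_edge hab hs0]; rfl

/-! ### Winding number of the boundary curve -/

namespace Pentagon

variable (P : Pentagon)

/-- The winding number of the boundary curve around a point. -/
noncomputable def windingNumber (z : ℂ) : ℝ :=
  (∑ k, turn (P.vertex k) (P.vertex (k + 1)) z) / (2 * Real.pi)

variable {P}

theorem notMem_edge_of_notMem_boundary {z : ℂ} (hz : z ∉ P.boundary) (k : Fin 5) :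
    z ∉ segment ℝ (P.vertex k) (P.vertex (k + 1)) :=
  fun h => hz (Set.mem_iUnion.2 ⟨k, h⟩)

theorem isCompact_edge (k : Fin 5) : IsCompact (P.edge k) := by
  rw [edge, segment_eq_image_lineMap]
  exact isCompact_Icc.image AffineMap.lineMap_continuous

theorem isCompact_boundary : IsCompact P.boundary :=
  isCompact_iUnion fun _ => isCompact_edge _

theorem isOpen_compl_boundary : IsOpen P.boundaryᶜ :=
  isCompact_boundary.isClosed.isOpen_compl

theorem exists_int_windingNumber {z : ℂ} (hz : z ∉ P.boundary) :
    ∃ m : ℤ, P.windingNumber z = m := by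
  have h (k : Fin 5) : P.vertex k - z ≠ 0 := fun h =>
    notMem_edge_of_notMem_boundary hz k (by rw [← sub_eq_zero.1 h]; exact left_mem_segment ℝ _ _)
  obtain ⟨m, hm⟩ := exists_int_sum_arg Finset.univ
    (fun k => (P.vertex (k + 1) - z) / (P.vertex k - z)) (by
      have e : ∏ k, (P.vertex (k + 1) - z) = ∏ k, (P.vertex k - z) :=
        Equiv.prod_comp (Equiv.addRight (1 : Fin 5)) (fun k => P.vertex k - z)
      rw [Finset.prod_div_distrib, e]
      exact div_self (Finset.prod_ne_zero_iff.2 fun k _ => h k))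
  refine ⟨m, ?_⟩
  rw [windingNumber, div_eq_iff Real.two_pi_pos.ne']
  exact hm

theorem continuousAt_windingNumber {z : ℂ} (hz : z ∉ P.boundary) :
    ContinuousAt P.windingNumber z := by
  unfold windingNumber
  exact ContinuousAt.div_const (tendsto_finsetSum _ fun k _ =>
    continuousAt_turn (notMem_edge_of_notMem_boundary hz k)) _

/-- A continuous function with integer values is constant on a preconnected set. -/
theorem windingNumber_eq_of_isPreconnected {S : Set ℂ} (hS : IsPreconnected S)
    (h : S ⊆ P.boundaryᶜ) {z w : ℂ} (hz : z ∈ S) (hw : w ∈ S) :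
    P.windingNumber z = P.windingNumber w := by
  have hT : IsDiscrete (Set.range ((↑) : ℤ → ℝ)) :=
    isDiscrete_iff_discreteTopology.2
      (Int.isClosedEmbedding_coe_real.isEmbedding.toHomeomorph.symm.isEmbedding.discreteTopology)
  exact hS.constant_of_mapsTo hT
    (fun x hx => (continuousAt_windingNumber (h hx)).continuousWithinAt)
    (fun x hx => by
      obtain ⟨m, hm⟩ := exists_int_windingNumber (h hx)
      exact ⟨m, hm.symm⟩) hz hw

theorem tendsto_windingNumber : Tendsto P.windingNumber (Bornology.cobounded ℂ) (𝓝 0) := by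
  have h (a b : ℂ) : Tendsto (turn a b) (Bornology.cobounded ℂ) (𝓝 0) := by
    have h1 : Tendsto (fun z => (b - z) / (a - z)) (Bornology.cobounded ℂ) (𝓝 1) := by
      have h2 : Tendsto (fun z : ℂ => (b - a) * (a - z)⁻¹ + 1) (Bornology.cobounded ℂ)
          (𝓝 ((b - a) * 0 + 1)) := by
        exact ((tendsto_inv₀_cobounded.comp (tendsto_const_sub_cobounded a)).const_mul _).add_const
            _
      simp only [mul_zero, zero_add] at h2
      refine h2.congr' ?_
      filter_upwards [Bornology.isBounded_def.1 (Bornology.isBounded_singleton (x := a))] with z hz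
      have : a - z ≠ 0 := sub_ne_zero.2 (Ne.symm hz)
      field_simp
      ring
    have h3 := (Complex.continuousAt_arg (x := 1) (by simp)).tendsto
    rw [Complex.arg_one] at h3
    exact h3.comp h1
  unfold windingNumber
  have := (tendsto_finsetSum Finset.univ fun (k : Fin 5) _ =>
    h (P.vertex k) (P.vertex (k + 1))).div_const (2 * Real.pi)
  simpa using this

theorem eventually_windingNumber_eq_zero :
    ∀ᶠ z in Bornology.cobounded ℂ, z ∉ P.boundary ∧ P.windingNumber z = 0 := by
  filter_upwards [Bornology.isBounded_def.1 (isCompact_boundary (P := P)).isBounded,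
    tendsto_windingNumber.eventually (Metric.ball_mem_nhds 0 one_pos)] with z hz h
  refine ⟨hz, ?_⟩
  obtain ⟨m, hm⟩ := exists_int_windingNumber (P := P) hz
  rw [hm] at h
  replace h : dist (m : ℝ) 0 < 1 := h
  rw [dist_zero_right, Real.norm_eq_abs] at h
  have : |m| < 1 := by exact_mod_cast h
  rw [hm, Int.abs_lt_one_iff.1 this, Int.cast_zero]


variable (P) in
/-- The vector from the `k`-th vertex to the next one. -/
def edgeVec (k : Fin 5) : ℂ := P.vertex (k + 1) - P.vertex k

variable (P) in
/-- The point that divides the `k`-th edge in the ratio `s : 1 - s`. -/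
def edgePoint (k : Fin 5) (s : ℝ) : ℂ := P.vertex k + s * P.edgeVec k

theorem vertex_ne (k : Fin 5) : P.vertex k ≠ P.vertex (k + 1) := fun h => by
  have := P.injective h
  revert this
  fin_cases k <;> decide

theorem edgeVec_ne_zero (k : Fin 5) : P.edgeVec k ≠ 0 := sub_ne_zero.2 (vertex_ne k).symm

theorem edge_eq_image (k : Fin 5) : P.edge k = P.edgePoint k '' Set.Icc 0 1 := by
  rw [edge, segment_eq_image_lineMap]
  refine Set.image_congr fun s _ => ?_
  rw [AffineMap.lineMap_apply_module', edgePoint, edgeVec, Complex.real_smul]; ring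

theorem edgePoint_mem {k : Fin 5} {s : ℝ} (h0 : 0 ≤ s) (h1 : s ≤ 1) : P.edgePoint k s ∈ P.edge k :=
    by
  rw [edge_eq_image]; exact ⟨s, ⟨h0, h1⟩, rfl⟩

theorem edgePoint_injective (k : Fin 5) : Function.Injective (P.edgePoint k) := fun s t h => by
  have := mul_right_cancel₀ (edgeVec_ne_zero (P := P) k) (add_left_cancel h)
  exact_mod_cast this

theorem edgePoint_zero (k : Fin 5) : P.edgePoint k 0 = P.vertex k := by simp [edgePoint]

theorem edgePoint_one (k : Fin 5) : P.edgePoint k 1 = P.vertex (k + 1) := by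
  simp [edgePoint, edgeVec]

theorem edgePoint_notMem {k l : Fin 5} (hkl : l ≠ k) {s : ℝ} (h0 : 0 < s) (h1 : s < 1) :
    P.edgePoint k s ∉ P.edge l := fun h => by
  have h2 := (P.simple k l hkl.symm).le ⟨edgePoint_mem h0.le h1.le, h⟩
  rcases h2.1 with h2 | h2
  · rw [← edgePoint_zero] at h2
    exact h0.ne' (edgePoint_injective k h2)
  · rw [Set.mem_singleton_iff, ← edgePoint_one] at h2
    exact h1.ne (edgePoint_injective k h2)

/-- The winding number increases by one when an edge is crossed from right to left. -/
theorem windingNumber_jump (k : Fin 5) {s : ℝ} (hs0 : 0 < s) (hs1 : s < 1) :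
    Tendsto (fun t : ℝ =>
      P.windingNumber (P.edgePoint k s + t * (Complex.I * P.edgeVec k)) -
      P.windingNumber (P.edgePoint k s + (-t : ℝ) * (Complex.I * P.edgeVec k))) (𝓝[>] 0) (𝓝 1) := by
  have hneg : Tendsto (fun t : ℝ => -t) (𝓝[>] 0) (𝓝[<] 0) := by
    have := tendsto_neg_nhdsGT (a := (0 : ℝ))
    rwa [neg_zero] at this
  have h (l : Fin 5) : Tendsto (fun t : ℝ =>
      turn (P.vertex l) (P.vertex (l + 1)) (P.edgePoint k s + t * (Complex.I * P.edgeVec k)) -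
      turn (P.vertex l) (P.vertex (l + 1)) (P.edgePoint k s + (-t : ℝ) * (Complex.I * P.edgeVec k)))
      (𝓝[>] 0) (𝓝 (if l = k then 2 * Real.pi else 0)) := by
    split_ifs with hl
    · subst hl
      have h1 := tendsto_turn_left (vertex_ne (P := P) l) hs0 hs1
      have h2 := (tendsto_turn_right (vertex_ne (P := P) l) hs0 hs1).comp hneg
      rw [show 2 * Real.pi = Real.pi - -Real.pi by ring]
      exact h1.sub h2
    · have hc := continuousAt_turn (edgePoint_notMem hl hs0 hs1 : P.edgePoint k s ∉ segment ℝ _ _)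
      have hx : Tendsto (fun t : ℝ => P.edgePoint k s + t * (Complex.I * P.edgeVec k)) (𝓝 0)
          (𝓝 (P.edgePoint k s)) := by
        have : Continuous (fun t : ℝ => P.edgePoint k s + t * (Complex.I * P.edgeVec k)) := by
          fun_prop
        convert this.tendsto 0 using 2
        simp
      have h1 := hc.tendsto.comp (hx.mono_left (nhdsWithin_le_nhds (s := Set.Ioi 0)))
      have h2 := hc.tendsto.comp ((hx.mono_left (nhdsWithin_le_nhds (s := Set.Iio 0))).comp hneg)
      have h3 := h1.sub h2
      rw [sub_self] at h3
      exact h3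
  have := (tendsto_finsetSum Finset.univ fun l _ => h l).div_const (2 * Real.pi)
  simp only [Finset.sum_ite_eq', Finset.mem_univ, if_true, div_self Real.two_pi_pos.ne'] at this
  refine this.congr fun t => ?_
  rw [Finset.sum_sub_distrib, sub_div]
  rfl

end Pentagon

/-! ### The two sides of the boundary; Jordan curve theorem -/

theorem cross_I_mul_right (x y : ℂ) : cross x (Complex.I * y) = x.re * y.re + x.im * y.im := by
  simp [cross]

theorem convex_halfPlane (σ : ℝ) (e p : ℂ) : Convex ℝ {z | 0 < σ * cross e (z - p)} := by
  intro z hz w hw a b ha hb hab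
  have : σ * cross e (a • z + b • w - p) = a * (σ * cross e (z - p)) + b * (σ * cross e (w - p)) :=
      by
    obtain rfl : a = 1 - b := by linarith
    simp [cross]
    ring
  show (0 : ℝ) < _
  rw [this]
  have hz : (0 : ℝ) < _ := hz
  have hw : (0 : ℝ) < _ := hw
  rcases ha.eq_or_lt with rfl | ha
  · obtain rfl : b = 1 := by linarith
    simpa using hw
  · have := mul_pos ha hz
    have := mul_nonneg hb hw.le
    linarith

/-- The linear functional given by the cross product with a fixed vector. -/
def crossLeft (e : ℂ) : ℂ →ₗ[ℝ] ℝ where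
  toFun := cross e
  map_add' := cross_add_right e
  map_smul' s z := by simp [cross_mul_right]

theorem volume_line {e : ℂ} (he : e ≠ 0) (p : ℂ) :
    MeasureTheory.volume {z | cross e (z - p) = 0} = 0 := by
  have h := MeasureTheory.Measure.addHaar_affineSubspace MeasureTheory.volume
    (AffineSubspace.mk' p (LinearMap.ker (crossLeft e))) (fun h => by
      have : p + Complex.I * e ∈ AffineSubspace.mk' p (LinearMap.ker (crossLeft e)) := by
        rw [h]; trivial
      rw [AffineSubspace.mem_mk', vsub_eq_sub, add_sub_cancel_left, LinearMap.mem_ker] at this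
      replace this : cross e (Complex.I * e) = 0 := this
      rw [cross_I_mul_right, ← sq, ← sq, ← norm_sq_eq] at this
      exact he (by simpa using this))
  convert h using 2
  ext z
  show _ ↔ z ∈ AffineSubspace.mk' p (LinearMap.ker (crossLeft e))
  rw [AffineSubspace.mem_mk', LinearMap.mem_ker]
  rfl

theorem eventually_mul_add_pos {s κ c : ℝ} (hs : 0 < s) (hκ : 0 ≤ κ) (h : κ = 0 → 0 < c) :
    ∀ᶠ t : ℝ in 𝓝[>] 0, 0 < s * κ + t * c := by
  rcases hκ.eq_or_lt with rfl | hκ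
  · filter_upwards [self_mem_nhdsWithin] with t ht
    have := mul_pos (show 0 < t from ht) (h rfl)
    linarith
  · have h1 : Tendsto (fun t : ℝ => s * κ + t * c) (𝓝 0) (𝓝 (s * κ)) := by
      have : Continuous fun t : ℝ => s * κ + t * c := by fun_prop
      simpa using this.tendsto 0
    exact nhdsWithin_le_nhds (h1.eventually (lt_mem_nhds (mul_pos hs hκ)))

theorem eventually_ball {x d : ℂ} {ε : ℝ} {p : ℂ} (h : x ∈ Metric.ball p ε) :
    ∀ᶠ t : ℝ in 𝓝[>] 0, x + t * d ∈ Metric.ball p ε := by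
  have h1 : Tendsto (fun t : ℝ => x + t * d) (𝓝 0) (𝓝 x) := by
    have : Continuous fun t : ℝ => x + t * d := by fun_prop
    simpa using this.tendsto 0
  exact nhdsWithin_le_nhds (h1.eventually (Metric.isOpen_ball.mem_nhds h))

namespace Pentagon

variable {P : Pentagon}

variable (P) in
/-- The connected component of a point in the complement of the boundary curve. -/
def component (z : ℂ) : Set ℂ := connectedComponentIn P.boundaryᶜ z

theorem component_eq {S : Set ℂ} (hS : IsPreconnected S) (h : S ⊆ P.boundaryᶜ) {z w : ℂ}
    (hz : z ∈ S) (hw : w ∈ S) : P.component z = P.component w :=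
  connectedComponentIn_eq (hS.subset_connectedComponentIn hz h hw)

theorem mem_component {z : ℂ} (hz : z ∉ P.boundary) : z ∈ P.component z :=
  mem_connectedComponentIn hz

theorem windingNumber_eq_of_component_eq {z w : ℂ} (hz : z ∉ P.boundary) (hw : w ∉ P.boundary)
    (h : P.component z = P.component w) : P.windingNumber z = P.windingNumber w :=
  windingNumber_eq_of_isPreconnected isPreconnected_connectedComponentIn
    (connectedComponentIn_subset _ _) (show z ∈ P.component w from
        h ▸ mem_component hz) (mem_component hw)

theorem mem_inside_of_windingNumber_ne_zero {z : ℂ} (hz : z ∉ P.boundary)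
    (h : P.windingNumber z ≠ 0) : z ∈ P.inside := by
  refine ⟨hz, ?_⟩
  rw [Bornology.isBounded_def]
  filter_upwards [P.eventually_windingNumber_eq_zero] with w hw hw'
  refine h ?_
  rw [← hw.2]
  exact windingNumber_eq_of_isPreconnected isPreconnected_connectedComponentIn
    (connectedComponentIn_subset _ _) (mem_component hz) hw'

theorem cross_sub_edgePoint (k : Fin 5) (s : ℝ) (z : ℂ) :
    cross (P.edgeVec k) (z - P.edgePoint k s) = cross (P.edgeVec k) (z - P.vertex k) := by
  rw [edgePoint, ← sub_sub, cross_sub_right _ (z - P.vertex k), cross_mul_right, cross_self_right]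
  ring

theorem cross_sub_vertex_succ (k : Fin 5) (z : ℂ) :
    cross (P.edgeVec k) (z - P.vertex (k + 1)) = cross (P.edgeVec k) (z - P.vertex k) := by
  rw [← edgePoint_one, cross_sub_edgePoint]

theorem cross_eq_zero_of_mem_edge {k : Fin 5} {z : ℂ} (hz : z ∈ P.edge k) :
    cross (P.edgeVec k) (z - P.vertex k) = 0 := by
  rw [edge_eq_image] at hz
  obtain ⟨s, -, rfl⟩ := hz
  rw [← cross_sub_edgePoint k s, sub_self]
  simp [cross]

variable (P) in
/-- The points close to the interior of the `k`-th edge, on the side given by the sign of `σ`,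
lie in the
component `C` of the complement of the boundary curve. -/
def IsEdgeSide (k : Fin 5) (σ : ℝ) (C : Set ℂ) : Prop :=
  ∀ s, 0 < s → s < 1 → ∃ ε > 0, ∀ z ∈ Metric.ball (P.edgePoint k s) ε,
    0 < σ * cross (P.edgeVec k) (z - P.vertex k) → z ∉ P.boundary ∧ P.component z = C

/-- A compact piece of an open edge keeps a positive distance from the other edges. One side of a
thin neighbourhood of it is thus convex and free of boundary points, so it lies in one component. -/
theorem exists_thickening_halfPlane (k : Fin 5) {s s' : ℝ} (h0 : 0 < s) (h1 : s' < 1) :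
    ∃ ε > 0, ∀ σ : ℝ, Convex ℝ (Metric.thickening ε (P.edgePoint k '' Set.Icc s s') ∩
      {z | 0 < σ * cross (P.edgeVec k) (z - P.vertex k)}) ∧
      Metric.thickening ε (P.edgePoint k '' Set.Icc s s') ∩
      {z | 0 < σ * cross (P.edgeVec k) (z - P.vertex k)} ⊆ P.boundaryᶜ := by
  have hc : Continuous (P.edgePoint k) := by unfold edgePoint; fun_prop
  have hK : IsCompact (P.edgePoint k '' Set.Icc s s') := isCompact_Icc.image hc
  have hO : IsOpen (⋃ l : {l // l ≠ k}, P.edge l)ᶜ :=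
    (isClosed_iUnion_of_finite fun l => (isCompact_edge _).isClosed).isOpen_compl
  obtain ⟨ε, hε, hsub⟩ := hK.exists_thickening_subset_open hO (by
    rintro _ ⟨u, hu, rfl⟩ hmem
    obtain ⟨⟨l, hl⟩, h⟩ := Set.mem_iUnion.1 hmem
    exact edgePoint_notMem hl (h0.trans_le hu.1) (hu.2.trans_lt h1) h)
  refine ⟨ε, hε, fun σ => ⟨Convex.inter (Convex.thickening ?_ _) (convex_halfPlane _ _ _), ?_⟩⟩
  · rintro _ ⟨u, hu, rfl⟩ _ ⟨u', hu', rfl⟩ a b ha hb hab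
    refine ⟨a * u + b * u', convex_Icc s s' hu hu' ha hb hab, ?_⟩
    obtain rfl : a = 1 - b := by linarith
    simp only [edgePoint, Complex.real_smul]
    push_cast
    ring
  · rintro z ⟨hz, hz'⟩ hzB
    obtain ⟨l, hl⟩ := Set.mem_iUnion.1 hzB
    by_cases hlk : l = k
    · subst hlk
      have hz' : (0 : ℝ) < _ := hz'
      rw [cross_eq_zero_of_mem_edge hl] at hz'
      simp at hz'
    · exact hsub hz (Set.mem_iUnion.2 ⟨⟨l, hlk⟩, hl⟩)

theorem eventually_side (k : Fin 5) (s : ℝ) {σ : ℝ} (hσ : σ ≠ 0) : ∀ᶠ t : ℝ in 𝓝[>] 0,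
    0 < σ * cross (P.edgeVec k) (P.edgePoint k s + t * (σ * (Complex.I * P.edgeVec k)) - P.vertex
        k) := by
  filter_upwards [self_mem_nhdsWithin] with t ht
  rw [← cross_sub_edgePoint k s, add_sub_cancel_left, cross_mul_right, cross_mul_right,
    cross_I_mul_right, ← sq, ← sq, ← norm_sq_eq]
  have := norm_pos_iff.2 (edgeVec_ne_zero (P := P) k)
  have : 0 < σ ^ 2 := by positivity
  have := mul_pos (show 0 < t from ht) (mul_pos this (pow_pos (norm_pos_iff.2 (edgeVec_ne_zero (P
      := P) k)) 2))
  linarith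

theorem exists_isEdgeSide (k : Fin 5) {σ : ℝ} (hσ : σ ≠ 0) : ∃ C, P.IsEdgeSide k σ C := by
  obtain ⟨ε₀, hε₀, h₀⟩ := exists_thickening_halfPlane (P := P) k (s := 1 / 2) (s' := 1 / 2)
    (by norm_num) (by norm_num)
  have hball : ∀ ε > 0, P.edgePoint k (1 / 2) ∈ Metric.ball (P.edgePoint k (1 / 2)) ε :=
    fun ε hε => Metric.mem_ball_self hε
  have hsub : ∀ s s' : ℝ, ∀ u ∈ Set.Icc s s', ∀ ε, Metric.ball (P.edgePoint k u) ε ⊆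
      Metric.thickening ε (P.edgePoint k '' Set.Icc s s') := fun s s' u hu ε z hz =>
    Metric.mem_thickening_iff.2 ⟨_, ⟨u, hu, rfl⟩, hz⟩
  obtain ⟨t₀, ht₀, ht₀'⟩ := ((eventually_ball (hball ε₀ hε₀)).and (eventually_side k (1 / 2)
      hσ)).exists
  refine ⟨P.component (P.edgePoint k (1 / 2) + t₀ * (σ * (Complex.I * P.edgeVec k))),
      fun s hs0 hs1 => ?_⟩
  obtain ⟨ε, hε, h⟩ := exists_thickening_halfPlane (P := P) k (s := min s (1 / 2)) (s' :=
      max s (1 / 2))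
    (by positivity) (by simp [hs1]; norm_num)
  obtain ⟨t, ⟨ht, ht'⟩, ht''⟩ := (((eventually_ball (hball ε hε)).and
    (eventually_ball (hball ε₀ hε₀))).and (eventually_side k (1 / 2) hσ)).exists
  refine ⟨ε, hε, fun z hz hz' => ⟨(h σ).2 ⟨hsub _ _ s (by simp) ε hz, hz'⟩, ?_⟩⟩
  rw [component_eq (h σ).1.isPreconnected (h σ).2 ⟨hsub _ _ s (by simp) ε hz, hz'⟩
    ⟨hsub _ _ (1 / 2) (by simp) ε ht, ht''⟩]
  exact component_eq (h₀ σ).1.isPreconnected (h₀ σ).2 ⟨hsub _ _ (1 / 2) (by simp) ε₀ ht', ht''⟩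
    ⟨hsub _ _ (1 / 2) (by simp) ε₀ ht₀, ht₀'⟩

variable (P) in
/-- The directions at the vertex `k + 1` that lie between the two adjacent edges, on the side given
by the sign of `σ`. -/
def cornerSector (k : Fin 5) (σ : ℝ) : Set ℂ :=
  {d | (0 ≤ σ * cross (P.edgeVec k) (P.edgeVec (k + 1)) ∧
      0 < σ * cross (P.edgeVec k) d ∧ 0 < σ * cross (P.edgeVec (k + 1)) d) ∨
    (σ * cross (P.edgeVec k) (P.edgeVec (k + 1)) < 0 ∧
      (0 < σ * cross (P.edgeVec k) d ∨ 0 < σ * cross (P.edgeVec (k + 1)) d))}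

variable (P) in
/-- The inner product of two consecutive edge vectors. -/
noncomputable def cornerDot (k : Fin 5) : ℝ :=
  (P.edgeVec k).re * (P.edgeVec (k + 1)).re + (P.edgeVec k).im * (P.edgeVec (k + 1)).im

/-- Consecutive edges that are parallel must continue straight ahead: folding back would make them
overlap, against simplicity. -/
theorem cornerDot_pos {k : Fin 5} (h : cross (P.edgeVec k) (P.edgeVec (k + 1)) = 0) :
    0 < P.cornerDot k := by
  by_contra hd
  push Not at hd
  have ha := norm_pos_iff.2 (edgeVec_ne_zero (P := P) k)
  have hb := norm_pos_iff.2 (edgeVec_ne_zero (P := P) (k + 1))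
  have hsq := norm_sq_eq (P.edgeVec k)
  set N := ‖P.edgeVec k‖ ^ 2 with hN
  have hN0 : 0 < N := by positivity
  obtain ⟨l, hl⟩ : ∃ l, l = -P.cornerDot k / N := ⟨_, rfl⟩
  have hl0 : 0 ≤ l := by rw [hl]; exact div_nonneg (by linarith) hN0.le
  have hlN : l * N = -P.cornerDot k := by rw [hl]; field_simp
  have e : P.edgeVec (k + 1) = -(l : ℂ) * P.edgeVec k := by
    unfold cross at h
    unfold cornerDot at hlN
    apply Complex.ext
    · apply mul_left_cancel₀ hN0.ne'
      simp
      linear_combination (P.edgeVec (k + 1)).re * hsq - (P.edgeVec k).im * h + (P.edgeVec k).re *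
          hlN
    · apply mul_left_cancel₀ hN0.ne'
      simp
      linear_combination (P.edgeVec (k + 1)).im * hsq + (P.edgeVec k).re * h + (P.edgeVec k).im *
          hlN
  have hl1 : 0 < l := lt_of_le_of_ne hl0 (by
    rintro rfl
    exact edgeVec_ne_zero (P := P) (k + 1) (by rw [e]; simp))
  have hk : k + 1 ≠ k := by simp
  obtain ⟨u, hu0, hu1, hul⟩ : ∃ u : ℝ, 0 < u ∧ u < 1 ∧ u * l < 1 := by
    refine ⟨1 / (1 + l) / 2, by positivity, ?_, ?_⟩
    · rw [div_div, div_lt_one (by positivity)]; linarith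
    · rw [div_div, div_mul_eq_mul_div, div_lt_one (by positivity)]; linarith
  refine edgePoint_notMem (P := P) hk (s := 1 - u * l) (by linarith) (by nlinarith) ?_
  have : P.edgePoint k (1 - u * l) = P.edgePoint (k + 1) u := by
    unfold edgePoint
    rw [e, show P.vertex (k + 1) = P.vertex k + P.edgeVec k by simp [edgeVec]]
    push_cast
    ring
  rw [this]
  exact edgePoint_mem hu0.le hu1.le

theorem exists_ball_vertex (k : Fin 5) : ∃ ε > 0, ∀ z ∈ Metric.ball (P.vertex (k + 1)) ε,
    z ∈ P.boundary → z ∈ P.edge k ∨ z ∈ P.edge (k + 1) := by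
  have hO : IsOpen (⋃ l : {l // l ≠ k ∧ l ≠ k + 1}, P.edge l)ᶜ :=
    (isClosed_iUnion_of_finite fun l => (isCompact_edge _).isClosed).isOpen_compl
  obtain ⟨ε, hε, h⟩ := Metric.isOpen_iff.1 hO (P.vertex (k + 1)) (by
    rintro hmem
    obtain ⟨⟨l, hl, hl'⟩, h⟩ := Set.mem_iUnion.1 hmem
    have h1 : P.vertex (k + 1) ∈ P.edge (k + 1) := left_mem_segment ℝ _ _
    rcases ((P.simple (k + 1) l hl'.symm).le ⟨h1, h⟩).2 with h2 | h2
    · exact hl' (P.injective h2).symm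
    · exact hl (add_right_cancel (P.injective h2)).symm)
  refine ⟨ε, hε, fun z hz hzB => ?_⟩
  obtain ⟨l, hl⟩ := Set.mem_iUnion.1 hzB
  by_contra hcon
  push Not at hcon
  refine h hz (Set.mem_iUnion.2 ⟨⟨l, ?_, ?_⟩, hl⟩)
  · rintro rfl; exact hcon.1 hl
  · rintro rfl; exact hcon.2 hl

variable (P) in
/-- The points close to the vertex `k + 1`, on the side given by the sign of `σ`, lie in the
component `C` of the complement of the boundary curve. -/
def IsCornerSide (k : Fin 5) (σ : ℝ) (C : Set ℂ) : Prop :=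
  ∃ ε > 0, ∀ z ∈ Metric.ball (P.vertex (k + 1)) ε,
    z - P.vertex (k + 1) ∈ P.cornerSector k σ → z ∉ P.boundary ∧ P.component z = C

theorem corner_notMem_boundary {k : Fin 5} {ε : ℝ} (h : ∀ z ∈ Metric.ball (P.vertex (k + 1)) ε,
    z ∈ P.boundary → z ∈ P.edge k ∨ z ∈ P.edge (k + 1)) {σ : ℝ} {z : ℂ}
    (hz : z ∈ Metric.ball (P.vertex (k + 1)) ε) (hz' : z - P.vertex (k + 1) ∈ P.cornerSector k σ) :
    z ∉ P.boundary := by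
  intro hzB
  have hs := cross_swap (P.edgeVec k) (P.edgeVec (k + 1))
  rcases h z hz hzB with h | h <;> rw [edge_eq_image] at h <;> obtain ⟨s, ⟨hs0, hs1⟩, rfl⟩ := h
  · have e : P.edgePoint k s - P.vertex (k + 1) = ((s - 1 : ℝ) : ℂ) * P.edgeVec k := by
      rw [edgePoint, edgeVec]; push_cast; ring
    rw [e] at hz'
    rcases hz' with ⟨h1, h2, h3⟩ | ⟨h1, h2⟩ <;>
      simp only [cross_mul_right, cross_self_right, hs, mul_zero, lt_irrefl, false_or] at *
    nlinarith
  · have e : P.edgePoint (k + 1) s - P.vertex (k + 1) = (s : ℂ) * P.edgeVec (k + 1) := by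
      rw [edgePoint]; ring
    rw [e] at hz'
    rcases hz' with ⟨h1, h2, h3⟩ | ⟨h1, h2⟩ <;>
      simp only [cross_mul_right, cross_self_right, mul_zero, lt_irrefl, or_false] at *
    nlinarith

/-- If the sector opens by at most π, it is an intersection of convex sets. Otherwise it is a union
of two half-discs that share points in the direction of `P.edgeVec k - P.edgeVec (k + 1)`. -/
theorem isPreconnected_corner (k : Fin 5) {ε : ℝ} (hε : 0 < ε) (σ : ℝ) :
    IsPreconnected (Metric.ball (P.vertex (k + 1)) ε ∩
      {z | z - P.vertex (k + 1) ∈ P.cornerSector k σ}) := by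
  set p := P.vertex (k + 1)
  have c1 := (convex_ball p ε).inter (convex_halfPlane σ (P.edgeVec k) p)
  have c2 := (convex_ball p ε).inter (convex_halfPlane σ (P.edgeVec (k + 1)) p)
  rcases le_or_gt 0 (σ * cross (P.edgeVec k) (P.edgeVec (k + 1))) with h | h
  · convert (c1.inter c2).isPreconnected using 1
    ext z
    simp only [cornerSector, Set.mem_inter_iff, Set.mem_ofPred_eq, h, h.not_gt]
    tauto
  · have hs := cross_swap (P.edgeVec k) (P.edgeVec (k + 1))
    obtain ⟨t, ht, ht'⟩ := ((eventually_ball (d := P.edgeVec k - P.edgeVec (k + 1))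
      (Metric.mem_ball_self (x := p) hε)).and self_mem_nhdsWithin).exists
    have ht0 : 0 < t := ht'
    have m1 : p + t * (P.edgeVec k - P.edgeVec (k + 1)) ∈
        {z | 0 < σ * cross (P.edgeVec k) (z - p)} := by
      show (0 : ℝ) < _
      rw [add_sub_cancel_left, cross_mul_right, cross_sub_right, cross_self_right]
      nlinarith
    have m2 : p + t * (P.edgeVec k - P.edgeVec (k + 1)) ∈
        {z | 0 < σ * cross (P.edgeVec (k + 1)) (z - p)} := by
      show (0 : ℝ) < _
      rw [add_sub_cancel_left, cross_mul_right, cross_sub_right, cross_self_right, hs]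
      nlinarith
    convert IsPreconnected.union _ (Set.mem_inter ht m1) (Set.mem_inter ht m2)
      c1.isPreconnected c2.isPreconnected using 1
    ext z
    simp only [cornerSector, Set.mem_inter_iff, Set.mem_union, Set.mem_ofPred_eq, h, h.not_ge]
    tauto

/-- Close to a vertex the sector on a given side is connected and avoids the boundary. It contains
points beside the end of one edge and beside the start of the next, so the component is carried
round the corner. -/
theorem IsEdgeSide.isCornerSide {k : Fin 5} {σ : ℝ} (hσ : σ ≠ 0) {C C' : Set ℂ}
    (h : P.IsEdgeSide k σ C) (h' : P.IsEdgeSide (k + 1) σ C') : C' = C ∧ P.IsCornerSide k σ C := by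
  obtain ⟨ε, hε, hB⟩ := exists_ball_vertex (P := P) k
  have hpre := isPreconnected_corner (P := P) k hε σ
  have hsub : Metric.ball (P.vertex (k + 1)) ε ∩ {z | z - P.vertex (k + 1) ∈ P.cornerSector k σ} ⊆
    P.boundaryᶜ := fun z hz => corner_notMem_boundary hB hz.1 hz.2
  have hs := cross_swap (P.edgeVec k) (P.edgeVec (k + 1))
  set p := P.vertex (k + 1) with hp
  have hsmall : ∃ s : ℝ, 0 < s ∧ s < 1 ∧ P.edgePoint k (1 - s) ∈ Metric.ball p ε ∧
      P.edgePoint (k + 1) s ∈ Metric.ball p ε := by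
    have h1 := eventually_ball (d := -P.edgeVec k) (Metric.mem_ball_self (x := p) hε)
    have h2 := eventually_ball (d := P.edgeVec (k + 1)) (Metric.mem_ball_self (x := p) hε)
    obtain ⟨s, ⟨⟨h1, h2⟩, h3⟩⟩ := ((h1.and h2).and (Ioo_mem_nhdsGT (zero_lt_one' ℝ))).exists
    refine ⟨s, h3.1, h3.2, ?_, h2⟩
    convert h1 using 1
    rw [edgePoint, hp, edgeVec]
    push_cast
    ring
  obtain ⟨s, hs0, hs1, hsk, hsk'⟩ := hsmall
  obtain ⟨δ, hδ, hside⟩ := h (1 - s) (by linarith) (by linarith)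
  obtain ⟨δ', hδ', hside'⟩ := h' s hs0 hs1
  -- At a turn towards the side `σ`, a small displacement `t` off one edge does not cross the line
  -- of the other. At a straight vertex the first term vanishes and the positivity of `cornerDot`
  -- decides.
  have hpos (hκ : 0 ≤ σ * cross (P.edgeVec k) (P.edgeVec (k + 1))) :
      ∀ᶠ t : ℝ in 𝓝[>] 0, 0 < s * (σ * cross (P.edgeVec k) (P.edgeVec (k + 1))) +
        t * (σ ^ 2 * P.cornerDot k) :=
    eventually_mul_add_pos hs0 hκ fun h0 => by
      have := cornerDot_pos ((mul_eq_zero.1 h0).resolve_left hσ)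
      positivity
  have z1 : ∀ᶠ t : ℝ in 𝓝[>] 0, P.edgePoint k (1 - s) + t * (σ * (Complex.I * P.edgeVec k)) - p ∈
      P.cornerSector k σ := by
    have e (t : ℝ) : σ * cross (P.edgeVec (k + 1))
        (P.edgePoint k (1 - s) + t * (σ * (Complex.I * P.edgeVec k)) - p) =
        s * (σ * cross (P.edgeVec k) (P.edgeVec (k + 1))) + t * (σ ^ 2 * P.cornerDot k) := by
      rw [show P.edgePoint k (1 - s) + t * (σ * (Complex.I * P.edgeVec k)) - p =
        t * (σ * (Complex.I * P.edgeVec k)) - s * P.edgeVec k by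
          rw [edgePoint, hp, edgeVec]; push_cast; ring, cross_sub_right, cross_mul_right,
        cross_mul_right, cross_mul_right, cross_I_mul_right, hs, cornerDot]
      ring
    rcases le_or_gt 0 (σ * cross (P.edgeVec k) (P.edgeVec (k + 1))) with hκ | hκ
    · filter_upwards [hpos hκ, eventually_side k (1 - s) hσ] with t ht ht'
      exact Or.inl ⟨hκ, by rwa [hp, cross_sub_vertex_succ], by rwa [e]⟩
    · filter_upwards [eventually_side k (1 - s) hσ] with t ht'
      exact Or.inr ⟨hκ, Or.inl (by rwa [hp, cross_sub_vertex_succ])⟩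
  have z2 : ∀ᶠ t : ℝ in 𝓝[>] 0, P.edgePoint (k + 1) s + t * (σ * (Complex.I * P.edgeVec (k + 1))) -
      p ∈
      P.cornerSector k σ := by
    have e (t : ℝ) : σ * cross (P.edgeVec k)
        (P.edgePoint (k + 1) s + t * (σ * (Complex.I * P.edgeVec (k + 1))) - p) =
        s * (σ * cross (P.edgeVec k) (P.edgeVec (k + 1))) + t * (σ ^ 2 * P.cornerDot k) := by
      rw [show P.edgePoint (k + 1) s + t * (σ * (Complex.I * P.edgeVec (k + 1))) - p =
        t * (σ * (Complex.I * P.edgeVec (k + 1))) + s * P.edgeVec (k + 1) by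
          rw [edgePoint, hp]; ring, cross_add_right, cross_mul_right,
        cross_mul_right, cross_mul_right, cross_I_mul_right, cornerDot]
      ring
    rcases le_or_gt 0 (σ * cross (P.edgeVec k) (P.edgeVec (k + 1))) with hκ | hκ
    · filter_upwards [hpos hκ, eventually_side (k + 1) s hσ] with t ht ht'
      exact Or.inl ⟨hκ, by rwa [e], ht'⟩
    · filter_upwards [eventually_side (k + 1) s hσ] with t ht'
      exact Or.inr ⟨hκ, Or.inr ht'⟩
  obtain ⟨t, ⟨⟨ht1, ht2⟩, ht3⟩, ht4⟩ := (((z1.and (eventually_ball hsk)).and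
    (eventually_ball (Metric.mem_ball_self hδ))).and (eventually_side k (1 - s) hσ)).exists
  obtain ⟨t', ⟨⟨ht1', ht2'⟩, ht3'⟩, ht4'⟩ := (((z2.and (eventually_ball hsk')).and
    (eventually_ball (Metric.mem_ball_self hδ'))).and (eventually_side (k + 1) s hσ)).exists
  refine ⟨?_, ε, hε, fun z hz hz' => ⟨hsub ⟨hz, hz'⟩, ?_⟩⟩
  · rw [← (hside _ ht3 ht4).2, ← (hside' _ ht3' ht4').2]
    exact component_eq hpre hsub ⟨ht2', ht1'⟩ ⟨ht2, ht1⟩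
  · rw [← (hside _ ht3 ht4).2]
    exact component_eq hpre hsub ⟨hz, hz'⟩ ⟨ht2, ht1⟩

theorem exists_isSide {σ : ℝ} (hσ : σ ≠ 0) :
    ∃ C, ∀ k, P.IsEdgeSide k σ C ∧ P.IsCornerSide k σ C := by
  choose C hC using fun k => exists_isEdgeSide (P := P) k hσ
  have hstep (k : Fin 5) := (hC k).isCornerSide hσ (hC (k + 1))
  have hall : ∀ k, C k = C 0 := by
    have h1 : C 1 = C 0 := (hstep 0).1
    have h2 : C 2 = C 1 := (hstep 1).1
    have h3 : C 3 = C 2 := (hstep 2).1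
    have h4 : C 4 = C 3 := (hstep 3).1
    intro k
    fin_cases k
    exacts [rfl, h1, h2.trans h1, h3.trans (h2.trans h1), h4.trans (h3.trans (h2.trans h1))]
  exact ⟨C 0, fun k => ⟨hall k ▸ hC k, hall k ▸ (hstep k).2⟩⟩

end Pentagon

namespace Pentagon

variable {P : Pentagon}

theorem exists_generic {z : ℂ} {ε : ℝ} (hε : 0 < ε) :
    ∃ w ∈ Metric.ball z ε, ∀ k, cross (P.edgeVec k) (w - P.vertex k) ≠ 0 := by
  have h0 : MeasureTheory.volume (⋃ k, {w | cross (P.edgeVec k) (w - P.vertex k) = 0}) = 0 :=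
    MeasureTheory.measure_iUnion_null fun k => volume_line (edgeVec_ne_zero k) _
  by_contra hcon
  push Not at hcon
  have : Metric.ball z ε ⊆ ⋃ k, {w | cross (P.edgeVec k) (w - P.vertex k) = 0} := fun w hw => by
    obtain ⟨k, hk⟩ := hcon w hw
    exact Set.mem_iUnion.2 ⟨k, hk⟩
  exact (Metric.measure_ball_pos MeasureTheory.volume z hε).ne'
    (MeasureTheory.measure_mono_null this h0)

/-- At a straight vertex, the identity `hid` makes both cross products have the same sign. At a
genuine turn the two sectors are complementary away from the edge lines. -/
theorem mem_cornerSector_or {k : Fin 5} {d : ℂ} (ha : cross (P.edgeVec k) d ≠ 0)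
    (hb : cross (P.edgeVec (k + 1)) d ≠ 0) :
    d ∈ P.cornerSector k 1 ∨ d ∈ P.cornerSector k (-1) := by
  have hd := cornerDot_pos (P := P) (k := k)
  have hid : ‖P.edgeVec k‖ ^ 2 * cross (P.edgeVec (k + 1)) d =
      P.cornerDot k * cross (P.edgeVec k) d - cross (P.edgeVec k) (P.edgeVec (k + 1)) *
        ((P.edgeVec k).re * d.re + (P.edgeVec k).im * d.im) := by
    rw [norm_sq_eq, cornerDot, cross, cross, cross]; ring
  have hN : 0 < ‖P.edgeVec k‖ ^ 2 := pow_pos (norm_pos_iff.2 (edgeVec_ne_zero k)) 2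
  show (_ ∨ _) ∨ (_ ∨ _)
  generalize cross (P.edgeVec k) (P.edgeVec (k + 1)) = κ at *
  generalize cross (P.edgeVec k) d = x at *
  generalize cross (P.edgeVec (k + 1)) d = y at *
  generalize ‖P.edgeVec k‖ ^ 2 = N at *
  generalize P.cornerDot k = c at *
  simp only [one_mul, neg_mul, Left.nonneg_neg_iff, Left.neg_pos_iff, Left.neg_neg_iff]
  rcases lt_trichotomy κ 0 with hκ | hκ | hκ
  · rcases ha.lt_or_gt with ha | ha <;> rcases hb.lt_or_gt with hb | hb <;>
      simp [hκ, hκ.not_gt, hκ.le, hκ.not_ge, ha, hb, ha.not_gt, hb.not_gt]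
  · subst hκ
    have hc := hd rfl
    rcases ha.lt_or_gt with ha | ha <;> rcases hb.lt_or_gt with hb | hb
    · simp [ha, hb]
    · nlinarith [mul_pos hN hb, mul_pos hc (neg_pos.2 ha)]
    · nlinarith [mul_pos hN (neg_pos.2 hb), mul_pos hc ha]
    · simp [ha, hb]
  · rcases ha.lt_or_gt with ha | ha <;> rcases hb.lt_or_gt with hb | hb <;>
      simp [hκ, hκ.not_gt, hκ.le, hκ.not_ge, ha, hb, ha.not_gt, hb.not_gt]

theorem smul_mem_cornerSector {k : Fin 5} {σ : ℝ} {d : ℂ} {t : ℝ} (ht : 0 < t)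
    (h : d ∈ P.cornerSector k σ) : (t : ℂ) * d ∈ P.cornerSector k σ := by
  have (e : ℂ) (h : 0 < σ * cross e d) : 0 < σ * cross e (t * d) := by
    rw [cross_mul_right, mul_left_comm]
    exact mul_pos ht h
  rcases h with ⟨h1, h2, h3⟩ | ⟨h1, h2 | h2⟩
  · exact Or.inl ⟨h1, this _ h2, this _ h3⟩
  · exact Or.inr ⟨h1, Or.inl (this _ h2)⟩
  · exact Or.inr ⟨h1, Or.inr (this _ h2)⟩

theorem eventually_segment_ball (p z : ℂ) {ε : ℝ} (hε : 0 < ε) :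
    ∀ᶠ t : ℝ in 𝓝[>] 0, p + t * (z - p) ∈ Metric.ball p ε :=
  eventually_ball (Metric.mem_ball_self hε)

/-- The complement of the boundary curve has at most two components. -/
theorem component_eq_or {C C' : Set ℂ} (hC : ∀ k, P.IsEdgeSide k 1 C ∧ P.IsCornerSide k 1 C)
    (hC' : ∀ k, P.IsEdgeSide k (-1) C' ∧ P.IsCornerSide k (-1) C') {z : ℂ} (hz : z ∉ P.boundary) :
    P.component z = C ∨ P.component z = C' := by
  obtain ⟨ε, hε, hball⟩ := Metric.isOpen_iff.1 (isOpen_compl_boundary (P := P)) z hz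
  -- Moving off all lines through edges ensures that the nearest boundary point is approached
  -- strictly from one side.
  obtain ⟨w, hw, hgen⟩ := exists_generic (P := P) (z := z) hε
  rw [component_eq (convex_ball z ε).isPreconnected hball (Metric.mem_ball_self hε) hw]
  have hwB : w ∉ P.boundary := hball hw
  -- The segment from `w` to a nearest boundary point `x` meets the boundary only at `x`, so `w`
  -- shares its component with points arbitrarily close to `x`.
  obtain ⟨x, hx, hdist⟩ := (isCompact_boundary (P := P)).exists_infDist_eq_dist
    ⟨P.vertex 0, Set.mem_iUnion.2 ⟨0, left_mem_segment ℝ _ _⟩⟩ w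
  have hpath (t : ℝ) (ht : t ∈ Set.Ioc (0 : ℝ) 1) : x + t * (w - x) ∈ P.boundaryᶜ := fun hB => by
    have h1 := Metric.infDist_le_dist_of_mem (x := w) hB
    have hne : 0 < dist w x := dist_pos.2 fun h => hwB (h ▸ hx)
    have h2 : dist w (x + t * (w - x)) = (1 - t) * dist w x := by
      rw [dist_eq_norm, dist_eq_norm, show w - (x + t * (w - x)) = ((1 - t : ℝ) : ℂ) * (w - x) by
        push_cast; ring, norm_mul, Complex.norm_real, Real.norm_of_nonneg (by linarith [ht.2])]
    rw [hdist, h2] at h1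
    nlinarith [mul_pos ht.1 hne]
  have hcomp (t : ℝ) (ht : t ∈ Set.Ioc (0 : ℝ) 1) :
      P.component w = P.component (x + t * (w - x)) := by
    have hc : IsPreconnected ((fun t : ℝ => x + t * (w - x)) '' Set.Ioc (0 : ℝ) 1) :=
      isPreconnected_Ioc.image _ (by fun_prop)
    refine component_eq hc ?_ ⟨1, by simp, by simp⟩ ⟨t, ht, rfl⟩
    rintro _ ⟨t, ht, rfl⟩
    exact hpath t ht
  have hvertex (k : Fin 5) (hxk : x = P.vertex (k + 1)) :
      P.component w = C ∨ P.component w = C' := by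
    have h1 : cross (P.edgeVec k) (w - x) ≠ 0 := by
      rw [hxk, cross_sub_vertex_succ]; exact hgen k
    have h2 : cross (P.edgeVec (k + 1)) (w - x) ≠ 0 := by
      rw [hxk]; exact hgen (k + 1)
    obtain ⟨ε₁, hε₁, hs₁⟩ := (hC k).2
    obtain ⟨ε₂, hε₂, hs₂⟩ := (hC' k).2
    obtain ⟨t, ⟨⟨ht1, ht2⟩, ht⟩⟩ := (((eventually_segment_ball x w hε₁).and
      (eventually_segment_ball x w hε₂)).and (Ioc_mem_nhdsGT (zero_lt_one' ℝ))).exists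
    rw [hcomp t ht]
    rw [hxk] at ht1 ht2 h1 h2 ⊢
    rcases mem_cornerSector_or h1 h2 with h | h
    · exact Or.inl (hs₁ _ ht1 (by
        rw [add_sub_cancel_left]; exact smul_mem_cornerSector ht.1 h)).2
    · exact Or.inr (hs₂ _ ht2 (by
        rw [add_sub_cancel_left]; exact smul_mem_cornerSector ht.1 h)).2
  obtain ⟨k, hk⟩ := Set.mem_iUnion.1 hx
  rw [edge_eq_image] at hk
  obtain ⟨s, ⟨hs0, hs1⟩, hsx⟩ := hk
  rcases hs0.eq_or_lt with rfl | hs0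
  · exact hvertex (k - 1) (by rw [← hsx, edgePoint_zero, sub_add_cancel])
  rcases hs1.eq_or_lt with rfl | hs1
  · exact hvertex k (by rw [← hsx, edgePoint_one])
  obtain ⟨ε₁, hε₁, hs₁⟩ := (hC k).1 s hs0 hs1
  obtain ⟨ε₂, hε₂, hs₂⟩ := (hC' k).1 s hs0 hs1
  obtain ⟨t, ⟨⟨ht1, ht2⟩, ht⟩⟩ := (((eventually_segment_ball x w hε₁).and
    (eventually_segment_ball x w hε₂)).and (Ioc_mem_nhdsGT (zero_lt_one' ℝ))).exists
  rw [hcomp t ht]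
  have hcr : cross (P.edgeVec k) (x + t * (w - x) - P.vertex k) =
      t * cross (P.edgeVec k) (w - P.vertex k) := by
    rw [← cross_sub_edgePoint k s, hsx, add_sub_cancel_left, cross_mul_right, ← hsx,
      cross_sub_edgePoint]
  rw [← hsx] at *
  rcases (hgen k).lt_or_gt with h | h
  · exact Or.inr (hs₂ _ ht2 (by rw [hcr]; nlinarith [ht.1])).2
  · exact Or.inl (hs₁ _ ht1 (by rw [hcr]; nlinarith [ht.1])).2

/-- The Jordan curve theorem for pentagons; `σ` is the orientation of the boundary curve. -/
theorem exists_orientation (P : Pentagon) : ∃ σ : ℝ, (σ = 1 ∨ σ = -1) ∧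
    (∀ z, z ∉ P.boundary → (z ∈ P.inside ∧ P.windingNumber z = σ) ∨
      (z ∉ P.inside ∧ P.windingNumber z = 0)) ∧
    (∀ k s, 0 < s → s < 1 → ∃ ε > 0, ∀ z ∈ Metric.ball (P.edgePoint k s) ε,
      0 < σ * cross (P.edgeVec k) (z - P.vertex k) → z ∈ P.inside) ∧
    (∀ k, ∃ ε > 0, ∀ z ∈ Metric.ball (P.vertex (k + 1)) ε,
      z - P.vertex (k + 1) ∈ P.cornerSector k σ → z ∈ P.inside) ∧
    (∀ k, ∃ ε > 0, ∀ z ∈ Metric.ball (P.vertex (k + 1)) ε,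
      z - P.vertex (k + 1) ∈ P.cornerSector k (-σ) → z ∉ P.inside) := by
  obtain ⟨C, hC⟩ := exists_isSide (P := P) (σ := 1) one_ne_zero
  obtain ⟨C', hC'⟩ := exists_isSide (P := P) (σ := -1) (by norm_num)
  have hor {z : ℂ} (hz : z ∉ P.boundary) := component_eq_or hC hC' hz
  -- winding numbers of the two components
  obtain ⟨z₁, z₂, hz₁, hz₂, hzC, hzC', hjump⟩ : ∃ z₁ z₂, z₁ ∉ P.boundary ∧ z₂ ∉ P.boundary ∧
      P.component z₁ = C ∧ P.component z₂ = C' ∧ P.windingNumber z₁ - P.windingNumber z₂ = 1 := by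
    obtain ⟨ε₁, hε₁, hs₁⟩ := (hC 0).1 (1 / 2) (by norm_num) (by norm_num)
    obtain ⟨ε₂, hε₂, hs₂⟩ := (hC' 0).1 (1 / 2) (by norm_num) (by norm_num)
    have e1 : ∀ᶠ t : ℝ in 𝓝[>] 0, P.edgePoint 0 (1 / 2) + t * (Complex.I * P.edgeVec 0) ∉
        P.boundary ∧
        P.component (P.edgePoint 0 (1 / 2) + t * (Complex.I * P.edgeVec 0)) = C := by
      filter_upwards [eventually_ball (d := Complex.I * P.edgeVec 0) (Metric.mem_ball_self hε₁),
        eventually_side (P := P) 0 (1 / 2) (one_ne_zero (α := ℝ))] with t h1 h2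
      rw [Complex.ofReal_one, one_mul (Complex.I * _)] at h2
      exact hs₁ _ h1 h2
    have e2 : ∀ᶠ t : ℝ in 𝓝[>] 0, P.edgePoint 0 (1 / 2) + (-t : ℝ) * (Complex.I * P.edgeVec 0) ∉
        P.boundary ∧
        P.component (P.edgePoint 0 (1 / 2) + (-t : ℝ) * (Complex.I * P.edgeVec 0)) = C' := by
      filter_upwards [eventually_ball (d := ((-1 : ℝ) : ℂ) * (Complex.I * P.edgeVec 0))
          (Metric.mem_ball_self hε₂),
        eventually_side (P := P) 0 (1 / 2) (σ := -1) (by norm_num)] with t h1 h2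
      have e : (t : ℂ) * (((-1 : ℝ) : ℂ) * (Complex.I * P.edgeVec 0)) =
          ((-t : ℝ) : ℂ) * (Complex.I * P.edgeVec 0) := by push_cast; ring
      rw [e] at h1 h2
      exact hs₂ _ h1 h2
    obtain ⟨t₀, ht₁, ht₂⟩ := (e1.and e2).exists
    refine ⟨_, _, ht₁.1, ht₂.1, ht₁.2, ht₂.2, ?_⟩
    -- The winding number is constant on each component, so the difference is constant for small `t`
    -- and equals the limiting jump.
    refine tendsto_nhds_unique (tendsto_const_nhds.congr' ?_)
      (windingNumber_jump (P := P) 0 (s := 1 / 2) (by norm_num) (by norm_num))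
    filter_upwards [e1, e2] with t h1 h2
    rw [windingNumber_eq_of_component_eq ht₁.1 h1.1 (ht₁.2.trans h1.2.symm),
      windingNumber_eq_of_component_eq ht₂.1 h2.1 (ht₂.2.trans h2.2.symm)]
  -- the component with winding number zero is unbounded
  have houtside {D D' : Set ℂ} (hD : ∀ z, z ∉ P.boundary → P.component z = D ∨ P.component z = D')
      (h0 : ∀ z, z ∉ P.boundary → P.component z = D → P.windingNumber z ≠ 0) {z : ℂ}
      (h : P.component z = D') : z ∉ P.inside := by
    rintro ⟨-, hb⟩
    obtain ⟨ζ, ⟨hζ, hζ0⟩, hζb⟩ := ((P.eventually_windingNumber_eq_zero).and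
      (Bornology.isBounded_def.1 hb)).exists
    refine hζb ?_
    show ζ ∈ P.component z
    rw [h, ← (hD ζ hζ).resolve_left fun h => h0 ζ hζ h hζ0]
    exact mem_component hζ
  have hne1 : (1 : ℝ) ≠ 0 := one_ne_zero
  have hw₁ {z : ℂ} (hz : z ∉ P.boundary) (h : P.component z = C) :
      P.windingNumber z = P.windingNumber z₁ :=
    windingNumber_eq_of_component_eq hz hz₁ (h.trans hzC.symm)
  have hw₂ {z : ℂ} (hz : z ∉ P.boundary) (h : P.component z = C') :
      P.windingNumber z = P.windingNumber z₂ :=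
    windingNumber_eq_of_component_eq hz hz₂ (h.trans hzC'.symm)
  have hin₁ (h : P.windingNumber z₁ ≠ 0) {z : ℂ} (hz : z ∉ P.boundary ∧ P.component z = C) :
      z ∈ P.inside := mem_inside_of_windingNumber_ne_zero hz.1 (by rwa [hw₁ hz.1 hz.2])
  have hin₂ (h : P.windingNumber z₂ ≠ 0) {z : ℂ} (hz : z ∉ P.boundary ∧ P.component z = C') :
      z ∈ P.inside := mem_inside_of_windingNumber_ne_zero hz.1 (by rwa [hw₂ hz.1 hz.2])
  -- A point far away has winding number 0 and lies in one of the two components. That one is the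
  -- outside; by the jump, the other has winding number ±1, which is the orientation.
  obtain ⟨ζ, hζ, hζ0⟩ := (P.eventually_windingNumber_eq_zero).exists
  rcases hor hζ with h | h
  · have v1 : P.windingNumber z₁ = 0 := by rw [← hw₁ hζ h, hζ0]
    have v2 : P.windingNumber z₂ = -1 := by linarith
    have n2 : P.windingNumber z₂ ≠ 0 := by rw [v2]; norm_num
    have hout {z : ℂ} (h : P.component z = C) : z ∉ P.inside :=
      houtside (fun z hz => (hor hz).symm) (fun z hz h => by rwa [hw₂ hz h]) h
    refine ⟨-1, Or.inr rfl, fun z hz => ?_, fun k s hs0 hs1 => ?_, fun k => ?_, fun k => ?_⟩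
    · rcases hor hz with h | h
      · exact Or.inr ⟨hout h, by rw [hw₁ hz h, v1]⟩
      · exact Or.inl ⟨hin₂ n2 ⟨hz, h⟩, by rw [hw₂ hz h, v2]⟩
    · obtain ⟨ε, hε, hs⟩ := (hC' k).1 s hs0 hs1
      exact ⟨ε, hε, fun z hz hz' => hin₂ n2 (hs z hz hz')⟩
    · obtain ⟨ε, hε, hs⟩ := (hC' k).2
      exact ⟨ε, hε, fun z hz hz' => hin₂ n2 (hs z hz hz')⟩
    · obtain ⟨ε, hε, hs⟩ := (hC k).2
      rw [neg_neg]
      exact ⟨ε, hε, fun z hz hz' => hout (hs z hz hz').2⟩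
  · have v2 : P.windingNumber z₂ = 0 := by rw [← hw₂ hζ h, hζ0]
    have v1 : P.windingNumber z₁ = 1 := by linarith
    have n1 : P.windingNumber z₁ ≠ 0 := by rw [v1]; norm_num
    have hout {z : ℂ} (h : P.component z = C') : z ∉ P.inside :=
      houtside (fun z hz => hor hz) (fun z hz h => by rwa [hw₁ hz h]) h
    refine ⟨1, Or.inl rfl, fun z hz => ?_, fun k s hs0 hs1 => ?_, fun k => ?_, fun k => ?_⟩
    · rcases hor hz with h | h
      · exact Or.inl ⟨hin₁ n1 ⟨hz, h⟩, by rw [hw₁ hz h, v1]⟩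
      · exact Or.inr ⟨hout h, by rw [hw₂ hz h, v2]⟩
    · obtain ⟨ε, hε, hs⟩ := (hC k).1 s hs0 hs1
      exact ⟨ε, hε, fun z hz hz' => hin₁ n1 (hs z hz hz')⟩
    · obtain ⟨ε, hε, hs⟩ := (hC k).2
      exact ⟨ε, hε, fun z hz hz' => hin₁ n1 (hs z hz hz')⟩
    · obtain ⟨ε, hε, hs⟩ := (hC' k).2
      exact ⟨ε, hε, fun z hz hz' => hout (hs z hz hz').2⟩

end Pentagon

/-! ### Area as the integral of the winding number -/

theorem volume_segment (a b : ℂ) : volume (segment ℝ a b) = 0 := by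
  by_cases h : a = b
  · subst h; simp
  · refine measure_mono_null ?_ (volume_line (sub_ne_zero.2 (Ne.symm h)) a)
    intro z hz
    rw [segment_eq_image_lineMap] at hz
    obtain ⟨s, -, rfl⟩ := hz
    show cross _ _ = 0
    rw [AffineMap.lineMap_apply_module', add_sub_cancel_right, Complex.real_smul, cross_mul_right,
      cross_self_right, mul_zero]

theorem ae_notMem_segment (a b : ℂ) : ∀ᵐ z : ℂ, z ∉ segment ℝ a b :=
  measure_eq_zero_iff_ae_notMem.1 (volume_segment a b)

theorem ae_cross_ne_zero {a b : ℂ} (h : a ≠ b) : ∀ᵐ z : ℂ, cross (a - z) (b - z) ≠ 0 := by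
  filter_upwards [measure_eq_zero_iff_ae_notMem.1 (volume_line (sub_ne_zero.2 h.symm) a)] with z hz
  intro h0
  refine hz ?_
  show cross _ _ = 0
  rw [← h0]
  simp only [cross, Complex.sub_re, Complex.sub_im]; ring

theorem volume_standard_simplex :
    volume {w : ℂ | 0 < w.re ∧ 0 < w.im ∧ w.re + w.im < 1} = ENNReal.ofReal (1 / 2) := by
  have h1 : {w : ℂ | 0 < w.re ∧ 0 < w.im ∧ w.re + w.im < 1} = Complex.measurableEquivRealProd ⁻¹'
      regionBetween (fun _ => 0) (fun x => 1 - x) (Set.Ioo 0 1) := by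
    ext w
    simp only [regionBetween, Set.mem_preimage, Set.mem_ofPred_eq, Set.mem_Ioo,
      Complex.measurableEquivRealProd_apply]
    constructor
    · rintro ⟨h1, h2, h3⟩
      exact ⟨⟨h1, by linarith⟩, h2, by linarith⟩
    · rintro ⟨⟨h1, h2⟩, h3, h4⟩
      exact ⟨h1, h3, by linarith⟩
  rw [h1, Complex.volume_preserving_equiv_real_prod.measure_preimage
    (measurableSet_regionBetween measurable_const (by fun_prop)
        measurableSet_Ioo).nullMeasurableSet,
    Measure.volume_eq_prod, volume_regionBetween_eq_integral]
  · congr 1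
    simp only [Pi.sub_apply, sub_zero]
    rw [← integral_Ioc_eq_integral_Ioo, ← intervalIntegral.integral_of_le zero_le_one,
      intervalIntegral.integral_sub (by simp) (by simp), integral_id,
      intervalIntegral.integral_const]
    norm_num
  · exact (continuous_const.integrableOn_Icc).mono_set Set.Ioo_subset_Icc_self
  · exact (Continuous.integrableOn_Icc (by fun_prop)).mono_set Set.Ioo_subset_Icc_self
  · exact measurableSet_Ioo
  · intro x hx
    show (0 : ℝ) ≤ 1 - x
    linarith [hx.2]

/-- The open triangle with vertices `a`, `b` and the origin, positively oriented. -/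
def openTriangle (a b : ℂ) : Set ℂ :=
  {z | 0 < cross (a - z) (b - z) ∧ 0 < cross (b - z) (0 - z) ∧ 0 < cross (0 - z) (a - z)}

theorem measurableSet_openTriangle (a b : ℂ) : MeasurableSet (openTriangle a b) := by
  have h (x y : ℂ) : IsOpen {z : ℂ | 0 < cross (x - z) (y - z)} := by
    refine isOpen_lt continuous_const ?_
    unfold cross
    fun_prop
  exact ((h _ _).inter ((h _ _).inter (h _ _))).measurableSet

/-- The triangle is the image of the standard simplex under a linear map of determinant `cross a b`;
in the degenerate case it is empty. -/
theorem volume_openTriangle {a b : ℂ} (h : 0 ≤ cross a b) :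
    volume (openTriangle a b) = ENNReal.ofReal (cross a b / 2) := by
  rcases h.eq_or_lt with h | h
  · have h0 : openTriangle a b = ∅ := by
      rw [Set.eq_empty_iff_forall_notMem]
      rintro z ⟨h1, h2, h3⟩
      have : cross (a - z) (b - z) + cross (b - z) (0 - z) + cross (0 - z) (a - z) = cross a b := by
        simp only [cross, Complex.sub_re, Complex.sub_im, Complex.zero_re, Complex.zero_im]; ring
      linarith
    rw [← h, zero_div, ENNReal.ofReal_zero, h0, measure_empty]
  · let f : ℂ →ₗ[ℝ] ℂ := Complex.reLm.smulRight a + Complex.imLm.smulRight b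
    have hf (w : ℂ) : f w = w.re * a + w.im * b := by simp [f]
    have hdet : LinearMap.det f = cross a b := by
      rw [← LinearMap.det_toMatrix Complex.basisOneI, Matrix.det_fin_two]
      simp [LinearMap.toMatrix_apply, hf, cross]
      ring
    have himage : openTriangle a b = f '' {w : ℂ | 0 < w.re ∧ 0 < w.im ∧ w.re + w.im < 1} := by
      ext z
      constructor
      · rintro ⟨h1, h2, h3⟩
        have e1 : cross (a - z) (b - z) = cross a b - cross z b - cross a z := by
          simp only [cross, Complex.sub_re, Complex.sub_im]; ring
        have e2 : cross (b - z) (0 - z) = cross z b := by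
          simp only [cross, Complex.sub_re, Complex.sub_im, Complex.zero_re, Complex.zero_im]; ring
        have e3 : cross (0 - z) (a - z) = cross a z := by
          simp only [cross, Complex.sub_re, Complex.sub_im, Complex.zero_re, Complex.zero_im]; ring
        rw [e1] at h1
        rw [e2] at h2
        rw [e3] at h3
        obtain ⟨x, hx⟩ : ∃ x, x * cross a b = cross z b := ⟨cross z b / cross a b, by field_simp⟩
        obtain ⟨y, hy⟩ : ∃ y, y * cross a b = cross a z := ⟨cross a z / cross a b, by field_simp⟩
        refine ⟨⟨x, y⟩, ⟨?_, ?_, ?_⟩, ?_⟩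
        · exact pos_of_mul_pos_left (hx ▸ h2) h.le
        · exact pos_of_mul_pos_left (hy ▸ h3) h.le
        · show x + y < 1
          nlinarith
        · rw [hf]
          apply Complex.ext <;> apply mul_left_cancel₀ h.ne'
          · simp [-mul_eq_mul_left_iff]
            unfold cross at *
            linear_combination a.re * hx + b.re * hy
          · simp [-mul_eq_mul_left_iff]
            unfold cross at *
            linear_combination a.im * hx + b.im * hy
      · rintro ⟨w, ⟨h1, h2, h3⟩, rfl⟩
        have e1 : cross (a - f w) (b - f w) = (1 - w.re - w.im) * cross a b := by
          rw [hf]; simp [cross]; ring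
        have e2 : cross (b - f w) (0 - f w) = w.re * cross a b := by
          rw [hf]; simp [cross]; ring
        have e3 : cross (0 - f w) (a - f w) = w.im * cross a b := by
          rw [hf]; simp [cross]; ring
        refine ⟨?_, ?_, ?_⟩
        · rw [e1]; exact mul_pos (by linarith) h
        · rw [e2]; exact mul_pos h1 h
        · rw [e3]; exact mul_pos h2 h
    rw [himage, Measure.addHaar_image_linearMap, hdet, volume_standard_simplex, abs_of_pos h,
      ← ENNReal.ofReal_mul h.le]
    congr 1
    ring

/-- The signed angle under which the closed triangle `a`, `b`, `0` is seen from `z`. -/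
noncomputable def triangleTurn (a b z : ℂ) : ℝ := turn a b z + turn b 0 z + turn 0 a z

theorem turn_self (a z : ℂ) : turn a a z = 0 := by
  rw [turn]
  by_cases h : a - z = 0
  · simp [h]
  · rw [div_self h, Complex.arg_one]

theorem triangleTurn_swap (a b : ℂ) :
    triangleTurn a b =ᵐ[volume] fun z => -triangleTurn b a z := by
  filter_upwards [ae_notMem_segment a b, ae_notMem_segment b 0,
      ae_notMem_segment 0 a] with z h1 h2 h3
  rw [triangleTurn, triangleTurn, turn_swap h1, turn_swap h2, turn_swap h3]
  ring

theorem triangleTurn_ae_eq {a b : ℂ} (h : 0 ≤ cross a b) : triangleTurn a b =ᵐ[volume]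
    (openTriangle a b).indicator fun _ => 2 * Real.pi := by
  have hsum (z : ℂ) : cross (a - z) (b - z) + cross (b - z) (0 - z) + cross (0 - z) (a - z) =
      cross a b := by
    simp only [cross, Complex.sub_re, Complex.sub_im, Complex.zero_re, Complex.zero_im]; ring
  by_cases hd : a = b ∨ b = 0 ∨ 0 = a
  · have h0 : cross a b = 0 := by
      rcases hd with rfl | rfl | rfl <;> simp [cross, mul_comm]
    filter_upwards [ae_notMem_segment a b, ae_notMem_segment b 0,
        ae_notMem_segment 0 a] with z h1 h2 h3
    rw [Set.indicator_of_notMem (by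
      rintro ⟨h1, h2, h3⟩
      linarith [hsum z]), triangleTurn]
    rcases hd with rfl | rfl | rfl
    · rw [turn_self, turn_swap h3]; ring
    · rw [turn_self, turn_swap h1]; ring
    · rw [turn_self, turn_swap h1]; ring
  · push Not at hd
    filter_upwards [ae_notMem_segment a b, ae_notMem_segment b 0, ae_notMem_segment 0 a,
      ae_cross_ne_zero hd.1, ae_cross_ne_zero hd.2.1, ae_cross_ne_zero hd.2.2] with z h1 h2 h3 g1
          g2 g3
    rw [triangleTurn, sum_turn_triangle g1 g2 g3 h1 h2 h3 (by
      rw [← hsum z] at h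
      convert h using 1
      simp [cross]; ring)]
    by_cases hz : z ∈ openTriangle a b
    · rw [Set.indicator_of_mem hz]
      exact if_pos hz
    · rw [Set.indicator_of_notMem hz]
      exact if_neg hz

/-- A single `turn` with distinct endpoints decays only like 1/|z| and is not integrable over the
plane. Closing it to a triangle through the origin gives ±2π times an indicator function, up to a
null set. -/
theorem integrable_triangleTurn_and_integral (a b : ℂ) : Integrable (triangleTurn a b) volume ∧
    ∫ z, triangleTurn a b z = Real.pi * cross a b := by
  have main (a b : ℂ) (h : 0 ≤ cross a b) : Integrable (triangleTurn a b) volume ∧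
      ∫ z, triangleTurn a b z = Real.pi * cross a b := by
    have hv := volume_openTriangle h
    constructor
    · rw [integrable_congr (triangleTurn_ae_eq h), integrable_indicator_iff
          (measurableSet_openTriangle a b)]
      exact integrableOn_const (by rw [hv]; exact ENNReal.ofReal_ne_top)
    · rw [integral_congr_ae (triangleTurn_ae_eq h), integral_indicator_const _
          (measurableSet_openTriangle a b),
        Measure.real, hv, ENNReal.toReal_ofReal (by linarith), smul_eq_mul]
      ring
  rcases le_total 0 (cross a b) with h | h
  · exact main a b h
  · obtain ⟨h1, h2⟩ := main b a (by rw [cross_swap]; linarith)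
    refine ⟨(integrable_congr (triangleTurn_swap a b)).2 h1.neg, ?_⟩
    rw [integral_congr_ae (triangleTurn_swap a b), integral_neg, h2, cross_swap a b]
    ring

namespace Pentagon

variable {P : Pentagon}

/-- The added turns along the segments from the vertices to the origin cancel in pairs, each segment
being run through once in either direction. -/
theorem windingNumber_ae_eq : P.windingNumber =ᵐ[volume] fun z =>
    (∑ k, triangleTurn (P.vertex k) (P.vertex (k + 1)) z) / (2 * Real.pi) := by
  filter_upwards [ae_all_iff.2 fun k => ae_notMem_segment (P.vertex k) 0] with z hz
  simp only [triangleTurn, windingNumber, Finset.sum_add_distrib]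
  have e : ∑ k, turn (P.vertex (k + 1)) 0 z = ∑ k, turn (P.vertex k) 0 z :=
    Equiv.sum_comp (Equiv.addRight (1 : Fin 5)) (fun k => turn (P.vertex k) 0 z)
  have e' : ∑ k, turn 0 (P.vertex k) z = -∑ k, turn (P.vertex k) 0 z := by
    rw [← Finset.sum_neg_distrib]
    exact Finset.sum_congr rfl fun k _ => turn_swap (hz k)
  rw [e, e']
  ring

theorem integral_windingNumber : ∫ z, P.windingNumber z = signedArea P.vertex := by
  rw [integral_congr_ae windingNumber_ae_eq, integral_div, integral_finsetSum _ fun k _ =>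
    (integrable_triangleTurn_and_integral _ _).1]
  simp only [(integrable_triangleTurn_and_integral _ _).2]
  rw [← Finset.mul_sum, signedArea]
  have := Real.pi_pos
  field_simp

theorem measurable_windingNumber : Measurable P.windingNumber := by
  unfold windingNumber
  exact (Finset.measurable_sum _ fun k _ => measurable_turn _ _).div_const _

variable (P) in
/-- The orientation of the boundary curve: `1` if it is traversed anticlockwise, `-1` otherwise. -/
noncomputable def orientation : ℝ := P.exists_orientation.choose

theorem orientation_eq : P.orientation = 1 ∨ P.orientation = -1 :=
  P.exists_orientation.choose_spec.1

theorem orientation_mul_self : P.orientation * P.orientation = 1 := by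
  rcases orientation_eq (P := P) with h | h <;> rw [h] <;> norm_num

theorem orientation_ne_zero : P.orientation ≠ 0 := fun h => by
  simpa [h] using orientation_mul_self (P := P)

theorem inside_or_outside {z : ℂ} (hz : z ∉ P.boundary) :
    (z ∈ P.inside ∧ P.windingNumber z = P.orientation) ∨
      (z ∉ P.inside ∧ P.windingNumber z = 0) :=
  P.exists_orientation.choose_spec.2.1 z hz

theorem exists_ball_inside_of_edgePoint (k : Fin 5) {s : ℝ} (h0 : 0 < s) (h1 : s < 1) :
    ∃ ε > 0, ∀ z ∈ Metric.ball (P.edgePoint k s) ε,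
      0 < P.orientation * cross (P.edgeVec k) (z - P.vertex k) → z ∈ P.inside :=
  P.exists_orientation.choose_spec.2.2.1 k s h0 h1

theorem exists_ball_inside_of_vertex (k : Fin 5) :
    ∃ ε > 0, ∀ z ∈ Metric.ball (P.vertex (k + 1)) ε,
      z - P.vertex (k + 1) ∈ P.cornerSector k P.orientation → z ∈ P.inside :=
  P.exists_orientation.choose_spec.2.2.2.1 k

theorem exists_ball_outside_of_vertex (k : Fin 5) :
    ∃ ε > 0, ∀ z ∈ Metric.ball (P.vertex (k + 1)) ε,
      z - P.vertex (k + 1) ∈ P.cornerSector k (-P.orientation) → z ∉ P.inside :=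
  P.exists_orientation.choose_spec.2.2.2.2 k

theorem ae_notMem_boundary : ∀ᵐ z : ℂ, z ∉ P.boundary :=
  measure_eq_zero_iff_ae_notMem.1 (measure_iUnion_null fun _ => volume_segment _ _)

/-- The shoelace formula. -/
theorem area_eq : P.area = P.orientation * signedArea P.vertex := by
  have hS : MeasurableSet {z | P.windingNumber z = P.orientation} :=
    measurable_windingNumber (measurableSet_singleton _)
  have h1 : P.region =ᵐ[volume] {z | P.windingNumber z = P.orientation} := by
    filter_upwards [ae_notMem_boundary (P := P)] with z hz
    apply propext
    show z ∈ P.boundary ∪ P.inside ↔ P.windingNumber z = P.orientation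
    rw [Set.mem_union, or_iff_right hz]
    rcases inside_or_outside hz with ⟨h, h'⟩ | ⟨h, h'⟩
    · simp [h, h']
    · simp [h, h', orientation_ne_zero.symm]
  have h2 : P.windingNumber =ᵐ[volume]
      {z | P.windingNumber z = P.orientation}.indicator fun _ => P.orientation := by
    filter_upwards [ae_notMem_boundary (P := P)] with z hz
    rcases inside_or_outside hz with ⟨h, h'⟩ | ⟨h, h'⟩
    · rw [Set.indicator_of_mem (show z ∈ {z | P.windingNumber z = P.orientation} from h'), h']
    · rw [Set.indicator_of_notMem (show z ∉ {z | P.windingNumber z = P.orientation} from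
        fun h'' => orientation_ne_zero (Eq.trans (Eq.symm h'') h')), h']
  rw [← integral_windingNumber, integral_congr_ae h2, integral_indicator_const _ hS, smul_eq_mul,
      mul_left_comm,
    orientation_mul_self, mul_one, area]
  exact measureReal_congr h1

theorem perimeter_eq : P.perimeter = closedLength P.vertex := by
  rw [perimeter, Fin.sum_univ_five, closedLength]
  simp only [edgeLength, dist_eq_norm, norm_sub_rev (P.vertex _) (P.vertex (_ + 1))]
  rfl

end Pentagon

/-! ### Interior angles and turns of the boundary -/

/-- The window (−π, π] may cut the sector in two. By periodicity it can be moved to (β, β + 2π],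
where the sector is the single interval (β, β + φ). -/
theorem volume_real_sin_sector (β : ℝ) {φ : ℝ} (h0 : 0 < φ) (h1 : φ ≤ Real.pi) :
    volume.real {θ | θ ∈ Set.Ioc (-Real.pi) Real.pi ∧
      (0 < Real.sin (θ - β) ∧ 0 < Real.sin (β + φ - θ))} = φ := by
  set S : Set ℝ := {θ | 0 < Real.sin (θ - β) ∧ 0 < Real.sin (β + φ - θ)} with hS
  have hpi := Real.pi_pos
  have hSm : MeasurableSet S := by
    have h2 : IsOpen {θ : ℝ | 0 < Real.sin (θ - β)} := isOpen_lt continuous_const (by fun_prop)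
    have h3 : IsOpen {θ : ℝ | 0 < Real.sin (β + φ - θ)} := isOpen_lt continuous_const (by fun_prop)
    exact (h2.inter h3).measurableSet
  have hper : Function.Periodic (S.indicator fun _ => (1 : ℝ)) (2 * Real.pi) := by
    intro θ
    have : θ + 2 * Real.pi ∈ S ↔ θ ∈ S := by
      show (_ ∧ _) ↔ (_ ∧ _)
      rw [show θ + 2 * Real.pi - β = θ - β + 2 * Real.pi by ring, Real.sin_add_two_pi,
        show β + φ - (θ + 2 * Real.pi) = β + φ - θ - 2 * Real.pi by ring, Real.sin_sub_two_pi]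
    by_cases h : θ ∈ S
    · rw [Set.indicator_of_mem h, Set.indicator_of_mem (this.2 h)]
    · rw [Set.indicator_of_notMem h, Set.indicator_of_notMem (mt this.1 h)]
  have hint (a : ℝ) : ∫ θ in a..(a + 2 * Real.pi), S.indicator (fun _ => (1 : ℝ)) θ =
      volume.real (Set.Ioc a (a + 2 * Real.pi) ∩ S) := by
    rw [intervalIntegral.integral_of_le (by linarith), setIntegral_indicator hSm, setIntegral_const,
      smul_eq_mul, mul_one]
  have hshift := hper.intervalIntegral_add_eq (-Real.pi) β
  rw [hint, hint, show -Real.pi + 2 * Real.pi = Real.pi by ring] at hshift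
  have heq : Set.Ioc β (β + 2 * Real.pi) ∩ S = Set.Ioo β (β + φ) := by
    ext θ
    constructor
    · rintro ⟨⟨h2, h3⟩, h4, h5⟩
      refine ⟨h2, ?_⟩
      have h6 : θ - β < Real.pi := by
        by_contra hcon
        push Not at hcon
        have := Real.sin_nonneg_of_nonneg_of_le_pi (x := θ - β - Real.pi) (by linarith)
            (by linarith)
        rw [Real.sin_sub_pi] at this
        linarith
      by_contra hcon
      push Not at hcon
      have := Real.sin_nonpos_of_nonpos_of_neg_pi_le (x := β + φ - θ) (by linarith) (by linarith)
      linarith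
    · rintro ⟨h2, h3⟩
      exact ⟨⟨h2, by linarith⟩, Real.sin_pos_of_pos_of_lt_pi (by linarith) (by linarith),
        Real.sin_pos_of_pos_of_lt_pi (by linarith) (by linarith)⟩
  rw [heq, Real.volume_real_Ioo, add_sub_cancel_left, max_eq_left h0.le] at hshift
  exact hshift

theorem cross_polar_left (p : ℂ) (θ : ℝ) :
    cross p (Complex.exp (θ * Complex.I)) = ‖p‖ * Real.sin (θ - Complex.arg p) := by
  have h1 := Complex.norm_mul_cos_arg p
  have h2 := Complex.norm_mul_sin_arg p
  rw [cross, Complex.exp_ofReal_mul_I_re, Complex.exp_ofReal_mul_I_im, Real.sin_sub]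
  linear_combination (-Real.sin θ) * h1 + Real.cos θ * h2

/-- The angle measure of a convex sector. -/
theorem volume_real_sector {p q : ℂ} (h : 0 < cross p q) :
    ∃ φ, 0 < φ ∧ φ < Real.pi ∧ Real.cos φ * (‖p‖ * ‖q‖) = p.re * q.re + p.im * q.im ∧
    volume.real {θ : ℝ | θ ∈ Set.Ioc (-Real.pi) Real.pi ∧
      (0 < cross p (Complex.exp (θ * Complex.I)) ∧ 0 < cross (Complex.exp (θ * Complex.I)) q)} = φ
          := by
  have hp : p ≠ 0 := by rintro rfl; simp [cross] at h
  have hq : q ≠ 0 := by rintro rfl; simp [cross] at h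
  have hp' := norm_pos_iff.2 hp
  have hq' := norm_pos_iff.2 hq
  have hcross := cross_polar_left p
  obtain ⟨r, rfl⟩ : ∃ r, q = p * r := ⟨q / p, by field_simp⟩
  have c1 := Complex.norm_mul_cos_arg p
  have c2 := Complex.norm_mul_sin_arg p
  have d1 := Complex.norm_mul_cos_arg r
  have d2 := Complex.norm_mul_sin_arg r
  have hN := norm_sq_eq p
  have him : 0 < r.im := by
    have : cross p (p * r) = ‖p‖ ^ 2 * r.im := by
      rw [hN, cross, Complex.mul_re, Complex.mul_im]; ring
    rw [this] at h
    exact pos_of_mul_pos_right h (by positivity)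
  have h0 : 0 < Complex.arg r := lt_of_le_of_ne (Complex.arg_nonneg_iff.2 him.le) fun h0 => by
    rw [← h0] at d2
    simp at d2
    exact him.ne d2
  have h1 : Complex.arg r < Real.pi := lt_of_le_of_ne (Complex.arg_le_pi r) fun h0 => by
    rw [h0] at d2
    simp at d2
    exact him.ne d2
  refine ⟨Complex.arg r, h0, h1, ?_, ?_⟩
  · rw [norm_mul, Complex.mul_re, Complex.mul_im]
    linear_combination ‖p‖ ^ 2 * d1 + r.re * hN
  · rw [← volume_real_sin_sector (Complex.arg p) h0 h1.le]
    congr 1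
    ext θ
    have e2 : cross (Complex.exp (θ * Complex.I)) (p * r) =
        ‖p‖ * ‖r‖ * Real.sin (Complex.arg p + Complex.arg r - θ) := by
      rw [cross, Complex.exp_ofReal_mul_I_re, Complex.exp_ofReal_mul_I_im, Real.sin_sub,
        Real.sin_add, Real.cos_add, Complex.mul_re, Complex.mul_im, ← c1, ← c2, ← d1, ← d2]
      ring
    have hr' : 0 < ‖r‖ := norm_pos_iff.2 (by rintro rfl; simp at hq)
    simp only [Set.mem_ofPred_eq, hcross, e2, mul_pos_iff_of_pos_left hp',
      mul_pos_iff_of_pos_left (mul_pos hp' hr')]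

theorem volume_real_half {p : ℂ} (hp : p ≠ 0) :
    volume.real {θ : ℝ | θ ∈ Set.Ioc (-Real.pi) Real.pi ∧
      0 < cross p (Complex.exp (θ * Complex.I))} = Real.pi := by
  have h := volume_real_sin_sector (Complex.arg p) Real.pi_pos le_rfl
  have hp' := norm_pos_iff.2 hp
  refine Eq.trans ?_ h
  congr 1
  ext θ
  have : Real.sin (Complex.arg p + Real.pi - θ) = Real.sin (θ - Complex.arg p) := by
    rw [show Complex.arg p + Real.pi - θ = Real.pi - (θ - Complex.arg p) by ring, Real.sin_pi_sub]
  simp only [Set.mem_ofPred_eq, cross_polar_left, mul_pos_iff_of_pos_left hp', this, and_self]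

theorem volume_cross_eq_zero {p : ℂ} (hp : p ≠ 0) :
    volume {θ : ℝ | cross p (Complex.exp (θ * Complex.I)) = 0} = 0 := by
  refine Set.Countable.measure_zero (Set.Countable.mono ?_
    (Set.countable_range fun n : ℤ => Complex.arg p + n * Real.pi)) _
  intro θ hθ
  have hθ : cross p (Complex.exp (θ * Complex.I)) = 0 := hθ
  rw [cross_polar_left, mul_eq_zero, or_iff_right (norm_ne_zero_iff.2 hp),
      Real.sin_eq_zero_iff] at hθ
  obtain ⟨n, hn⟩ := hθ
  exact ⟨n, by simp [hn]⟩

namespace Pentagon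

variable {P : Pentagon}

theorem eventually_mem_inside {k : Fin 5} {d : ℂ} (h : d ∈ P.cornerSector k P.orientation) :
    ∀ᶠ t : ℝ in 𝓝[>] 0, P.vertex (k + 1) + t * d ∈ P.inside := by
  obtain ⟨ε, hε, hs⟩ := exists_ball_inside_of_vertex (P := P) k
  filter_upwards [eventually_ball (d := d) (Metric.mem_ball_self hε),
      self_mem_nhdsWithin] with t h1 h2
  exact hs _ h1 (by rw [add_sub_cancel_left]; exact smul_mem_cornerSector h2 h)

theorem not_eventually_mem_inside {k : Fin 5} {d : ℂ} (h : d ∈ P.cornerSector k (-P.orientation)) :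
    ¬ ∀ᶠ t : ℝ in 𝓝[>] 0, P.vertex (k + 1) + t * d ∈ P.inside := by
  obtain ⟨ε, hε, hs⟩ := exists_ball_outside_of_vertex (P := P) k
  intro hin
  obtain ⟨t, ⟨h1, h2⟩, h3⟩ := (((eventually_ball (d := d) (Metric.mem_ball_self hε)).and
    self_mem_nhdsWithin).and hin).exists
  exact hs _ h1 (by rw [add_sub_cancel_left]; exact smul_mem_cornerSector h2 h) h3

theorem mem_cornerSector_or_neg {k : Fin 5} {d : ℂ} (ha : cross (P.edgeVec k) d ≠ 0)
    (hb : cross (P.edgeVec (k + 1)) d ≠ 0) :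
    d ∈ P.cornerSector k P.orientation ∨ d ∈ P.cornerSector k (-P.orientation) := by
  rcases orientation_eq (P := P) with h | h <;> rw [h]
  · exact mem_cornerSector_or ha hb
  · rw [neg_neg]; exact (mem_cornerSector_or ha hb).symm

variable (P) in
/-- The turn of the boundary curve at the vertex `k + 1`: positive at a vertex with angle less than
`π`, negative at a vertex with angle larger than `π`. -/
noncomputable def cornerTurn (k : Fin 5) : ℝ :=
  P.orientation * cross (P.edgeVec k) (P.edgeVec (k + 1))

/-- At a straight or reflex vertex every direction in the open half-plane on the interior side of
the incoming edge points inside. -/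
theorem pi_le_interiorAngle {k : Fin 5} (h : P.cornerTurn k ≤ 0) :
    Real.pi ≤ P.interiorAngle (k + 1) := by
  have ho := orientation_ne_zero (P := P)
  have hp : (P.orientation : ℂ) * P.edgeVec k ≠ 0 :=
    mul_ne_zero (by exact_mod_cast ho) (edgeVec_ne_zero k)
  rw [← volume_real_half hp, interiorAngle]
  refine measureReal_mono ?_ (measure_ne_top_of_subset (fun θ hθ => hθ.1)
    (measure_Ioc_lt_top (a := -Real.pi) (b := Real.pi)).ne)
  rintro θ ⟨hθ, hθ'⟩
  refine ⟨hθ, eventually_mem_inside ?_⟩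
  rw [cross_mul_left] at hθ'
  rcases h.eq_or_lt with h | h
  · refine Or.inl ⟨h.ge, hθ', ?_⟩
    have h0 := (mul_eq_zero.1 h).resolve_left ho
    have hid : ‖P.edgeVec k‖ ^ 2 * cross (P.edgeVec (k + 1)) (Complex.exp (θ * Complex.I)) =
        P.cornerDot k * cross (P.edgeVec k) (Complex.exp (θ * Complex.I)) := by
      generalize Complex.exp (θ * Complex.I) = d
      rw [norm_sq_eq, cornerDot]
      unfold cross at *
      linear_combination -((P.edgeVec k).re * d.re + (P.edgeVec k).im * d.im) * h0
    have hN : 0 < ‖P.edgeVec k‖ ^ 2 := pow_pos (norm_pos_iff.2 (edgeVec_ne_zero k)) 2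
    have hd := mul_pos (cornerDot_pos h0) hθ'
    refine pos_of_mul_pos_right (a := ‖P.edgeVec k‖ ^ 2) ?_ hN.le
    rwa [mul_left_comm, hid, mul_left_comm]
  · exact Or.inr ⟨h, Or.inl hθ'⟩

/-- Up to the null set of directions along the edges, the inward directions form the sector between
the outgoing edge and the reversed incoming edge. The reversal accounts for the minus sign before
`cornerDot`. -/
theorem interiorAngle_of_cornerTurn_pos {k : Fin 5} (h : 0 < P.cornerTurn k) :
    P.interiorAngle (k + 1) < Real.pi ∧
      Real.cos (P.interiorAngle (k + 1)) * (‖P.edgeVec k‖ * ‖P.edgeVec (k + 1)‖) =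
        -P.cornerDot k := by
  have hS : P.interiorAngle (k + 1) = volume.real {θ : ℝ | θ ∈ Set.Ioc (-Real.pi) Real.pi ∧
      (0 < P.orientation * cross (P.edgeVec k) (Complex.exp (θ * Complex.I)) ∧
      0 < P.orientation * cross (P.edgeVec (k + 1)) (Complex.exp (θ * Complex.I)))} := by
    refine measureReal_congr ?_
    filter_upwards [measure_eq_zero_iff_ae_notMem.1 (volume_cross_eq_zero (edgeVec_ne_zero (P :=
        P) k)),
      measure_eq_zero_iff_ae_notMem.1 (volume_cross_eq_zero (edgeVec_ne_zero (P :=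
          P) (k + 1)))] with θ h1 h2
    apply propext
    show (_ ∧ _) ↔ (_ ∧ _)
    refine and_congr_right fun _ => ⟨fun hin => ?_, fun hs => eventually_mem_inside (Or.inl ⟨h.le,
        hs⟩)⟩
    rcases mem_cornerSector_or_neg (P := P) h1 h2 with h3 | h3
    · rcases h3 with ⟨-, h3⟩ | ⟨h3, -⟩
      · exact h3
      · exact absurd h h3.not_gt
    · exact absurd hin (not_eventually_mem_inside h3)
  have hsw := cross_swap (P.edgeVec k) (P.edgeVec (k + 1))
  have hneg (x y : ℂ) : cross (-x) y = -cross x y := by simp [cross]; ring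
  have hneg' (x y : ℂ) : cross x (-y) = -cross x y := by simp [cross]; ring
  rw [hS]
  unfold cornerTurn at h
  rcases orientation_eq (P := P) with ho | ho <;> rw [ho] at h ⊢
  · obtain ⟨φ, -, h1, h2, h3⟩ := volume_real_sector (p := P.edgeVec (k + 1)) (q := -P.edgeVec k) (by
      rw [hneg', hsw]; linarith)
    have : {θ : ℝ | θ ∈ Set.Ioc (-Real.pi) Real.pi ∧
        (0 < 1 * cross (P.edgeVec k) (Complex.exp (θ * Complex.I)) ∧
        0 < 1 * cross (P.edgeVec (k + 1)) (Complex.exp (θ * Complex.I)))} =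
        {θ : ℝ | θ ∈ Set.Ioc (-Real.pi) Real.pi ∧
        (0 < cross (P.edgeVec (k + 1)) (Complex.exp (θ * Complex.I)) ∧
        0 < cross (Complex.exp (θ * Complex.I)) (-P.edgeVec k))} := by
      ext θ
      simp only [Set.mem_ofPred_eq, one_mul, hneg', ← cross_swap]
      tauto
    rw [this, h3]
    refine ⟨h1, ?_⟩
    rw [norm_neg] at h2
    rw [mul_comm ‖P.edgeVec k‖, h2, cornerDot]
    simp
    ring
  · obtain ⟨φ, -, h1, h2, h3⟩ := volume_real_sector (p := -P.edgeVec k) (q := P.edgeVec (k + 1)) (by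
      rw [hneg]; linarith)
    have : {θ : ℝ | θ ∈ Set.Ioc (-Real.pi) Real.pi ∧
        (0 < -1 * cross (P.edgeVec k) (Complex.exp (θ * Complex.I)) ∧
        0 < -1 * cross (P.edgeVec (k + 1)) (Complex.exp (θ * Complex.I)))} =
        {θ : ℝ | θ ∈ Set.Ioc (-Real.pi) Real.pi ∧
        (0 < cross (-P.edgeVec k) (Complex.exp (θ * Complex.I)) ∧
        0 < cross (Complex.exp (θ * Complex.I)) (P.edgeVec (k + 1)))} := by
      ext θ
      simp only [Set.mem_ofPred_eq, neg_mul, one_mul, hneg,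
        cross_swap (P.edgeVec (k + 1)) (Complex.exp _)]
    rw [this, h3]
    refine ⟨h1, ?_⟩
    rw [norm_neg] at h2
    rw [h2, cornerDot]
    simp
    ring

theorem cornerTurn_nonpos_of_pi_lt {k : Fin 5} (h : Real.pi < P.interiorAngle (k + 1)) :
    P.cornerTurn k ≤ 0 := by
  by_contra hcon
  exact absurd (interiorAngle_of_cornerTurn_pos (not_le.1 hcon)).1 h.not_gt

theorem cos_interiorAngle {k : Fin 5} (h : P.interiorAngle (k + 1) < Real.pi) :
    Real.cos (P.interiorAngle (k + 1)) * (‖P.edgeVec k‖ * ‖P.edgeVec (k + 1)‖) =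
      -P.cornerDot k := by
  refine (interiorAngle_of_cornerTurn_pos ?_).2
  by_contra hcon
  exact absurd (pi_le_interiorAngle (not_lt.1 hcon)) h.not_ge

end Pentagon

/-! ### Circumscribed pentagons: the perimeter of Cairo and Prismatic pentagons -/

/-- Two tangents to a circle of radius `r`, with directions `U` and `V`, that meet in a point at
distance `β` and `α` from the points of tangency. -/
theorem tangents_from_point {U V : ℂ} (hU : ‖U‖ = 1) (hV : ‖V‖ = 1) {α β r ε ε' C : ℝ}
    (hα : 0 ≤ α) (hβ : 0 ≤ β) (hr : 0 < r) (hε : ε = 1 ∨ ε = -1) (hε' : ε' = 1 ∨ ε' = -1)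
    (h : -(β : ℂ) * U + ε * r * (Complex.I * U) = α * V + ε' * r * (Complex.I * V))
    (hC : C = -(U.re * V.re + U.im * V.im)) (hC1 : C ≠ 1) :
    α = β ∧ ε' = ε ∧ C * (β ^ 2 + r ^ 2) = β ^ 2 - r ^ 2 := by
  have hU2 := norm_sq_eq U
  have hV2 := norm_sq_eq V
  rw [hU] at hU2
  rw [hV] at hV2
  have h1 := congrArg Complex.re h
  have h2 := congrArg Complex.im h
  simp at h1 h2
  have hεε : ε ^ 2 = 1 := by rcases hε with rfl | rfl <;> norm_num
  have hεε' : ε' ^ 2 = 1 := by rcases hε' with rfl | rfl <;> norm_num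
  have hsq : α ^ 2 = β ^ 2 := by
    have e1 : (-(β * U.re) + -(ε * r * U.im)) ^ 2 + (-(β * U.im) + ε * r * U.re) ^ 2 = β ^ 2 + r ^
        2 := by
      linear_combination (-(β ^ 2 + ε ^ 2 * r ^ 2)) * hU2 + r ^ 2 * hεε
    have e2 : (α * V.re + -(ε' * r * V.im)) ^ 2 + (α * V.im + ε' * r * V.re) ^ 2 = α ^ 2 + r ^ 2 :=
        by
      linear_combination (-(α ^ 2 + ε' ^ 2 * r ^ 2)) * hV2 + r ^ 2 * hεε'
    rw [h1, h2] at e1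
    linarith
  have hαβ : α = β := (sq_eq_sq₀ hα hβ).1 hsq
  subst hαβ
  -- The inner product of the two expressions for the vector from the vertex to the centre. Opposite
  -- signs `ε`, `ε'` would give C = 1, an angle of zero.
  have key : C * (α ^ 2 + r ^ 2) = α ^ 2 - ε * ε' * r ^ 2 := by
    rw [hC]
    linear_combination (U.re * α - U.im * ε' * r) * h1 + (U.im * α + U.re * ε' * r) * h2 +
      (-α ^ 2 + ε * ε' * r ^ 2) * hU2 + r ^ 2 * (U.re * V.re + U.im * V.im) * hεε'
  have hr2 : 0 < α ^ 2 + r ^ 2 := by positivity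
  by_cases hee : ε' = ε
  · subst hee
    refine ⟨rfl, rfl, ?_⟩
    rw [key, ← sq, hεε, one_mul]
  · exfalso
    have : ε * ε' = -1 := by
      rcases hε with rfl | rfl <;> rcases hε' with rfl | rfl <;> simp at hee ⊢
    rw [this] at key
    exact hC1 (mul_right_cancel₀ hr2.ne' (by rw [key]; ring))

namespace Pentagon

variable {P : Pentagon}

theorem sum_cross_sub (P : Pentagon) (c : ℂ) :
    ∑ k, cross (P.vertex k - c) (P.vertex (k + 1) - c) = 2 * signedArea P.vertex := by
  rw [← signedArea_sub_const P.vertex c, signedArea]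
  ring

theorem edgeLength_eq (k : Fin 5) : P.edgeLength k = ‖P.edgeVec k‖ := by
  rw [edgeLength, dist_eq_norm, norm_sub_rev]; rfl

theorem perimeter_pos : 0 < P.perimeter :=
  Finset.sum_pos (fun k _ => by rw [edgeLength_eq]; exact norm_pos_iff.2 (edgeVec_ne_zero k))
    ⟨0, Finset.mem_univ _⟩

/-- The lengths of the tangents from the vertices of a circumscribed pentagon. -/
theorem IsCircumscribed.exists_tangentLength (h : P.IsCircumscribed)
    (hang : ∀ k, P.interiorAngle k = Real.pi / 2 ∨ P.interiorAngle k = 2 * Real.pi / 3) :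
    ∃ (r : ℝ) (L : Fin 5 → ℝ), 0 < r ∧ (∀ k, P.interiorAngle k = Real.pi / 2 → L k = r) ∧
      (∀ k, P.interiorAngle k = 2 * Real.pi / 3 → √3 * L k = r) ∧
      P.perimeter = 2 * ∑ k, L k ∧ P.area = r * P.perimeter / 2 := by
  obtain ⟨c, r, hr, ht⟩ := h
  choose t htmem htdist htinner using ht
  have hs (k : Fin 5) : ∃ s, 0 ≤ s ∧ s ≤ 1 ∧ P.edgePoint k s = t k := by
    have := htmem k
    rw [edge_eq_image] at this
    obtain ⟨s, ⟨h0, h1⟩, h2⟩ := this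
    exact ⟨s, h0, h1, h2⟩
  choose s hs0 hs1 hst using hs
  have hℓ (k : Fin 5) : 0 < ‖P.edgeVec k‖ := norm_pos_iff.2 (edgeVec_ne_zero k)
  obtain ⟨U, hU⟩ : ∃ U : Fin 5 → ℂ, ∀ k, P.edgeVec k = ‖P.edgeVec k‖ * U k :=
    ⟨fun k => P.edgeVec k / ‖P.edgeVec k‖, fun k => by
      have : (‖P.edgeVec k‖ : ℂ) ≠ 0 := by exact_mod_cast (hℓ k).ne'
      field_simp⟩
  have hU1 (k : Fin 5) : ‖U k‖ = 1 := by
    have := congrArg norm (hU k)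
    rw [norm_mul, Complex.norm_real, norm_norm] at this
    exact (mul_eq_left₀ (hℓ k).ne').1 this.symm
  -- the unit normals
  have hε (k : Fin 5) : ∃ ε : ℝ, (ε = 1 ∨ ε = -1) ∧ c - t k = ε * r * (Complex.I * U k) := by
    have hdot : (t k - c).re * (U k).re + (t k - c).im * (U k).im = 0 := by
      have := htinner k
      rw [show P.vertex (k + 1) - P.vertex k = ‖P.edgeVec k‖ * U k from hU k, Complex.inner] at this
      simp at this
      apply mul_left_cancel₀ (hℓ k).ne'
      simp only [Complex.sub_re, Complex.sub_im, mul_zero]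
      linear_combination this
    have hn : (t k - c).re ^ 2 + (t k - c).im ^ 2 = r ^ 2 := by
      rw [← norm_sq_eq, ← dist_eq_norm, htdist]
    have hu := norm_sq_eq (U k)
    rw [hU1] at hu
    generalize U k = u at *
    have hc : c = t k - (t k - c) := by ring
    generalize t k - c = w at *
    have hcr : (cross w u - r) * (cross w u + r) = 0 := by
      unfold cross
      linear_combination -(w.re * u.re + w.im * u.im) * hdot - (w.re ^ 2 + w.im ^ 2) * hu + hn
    have hw : w = -cross w u * (Complex.I * u) := by
      apply Complex.ext
      · simp [cross]
        linear_combination w.re * hu + u.re * hdot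
      · simp [cross]
        linear_combination w.im * hu + u.im * hdot
    rcases mul_eq_zero.1 hcr with h | h
    · refine ⟨1, Or.inl rfl, ?_⟩
      rw [sub_eq_zero.1 h] at hw
      rw [hc]
      simp
      linear_combination -hw
    · refine ⟨-1, Or.inr rfl, ?_⟩
      rw [eq_neg_of_add_eq_zero_left h] at hw
      rw [hc]
      simp at hw ⊢
      linear_combination hw
  choose ε hε1 hεeq using hε
  have hcorner (k : Fin 5) : s (k + 1) * ‖P.edgeVec (k + 1)‖ = (1 - s k) * ‖P.edgeVec k‖ ∧
      ε (k + 1) = ε k ∧ Real.cos (P.interiorAngle (k + 1)) *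
        (((1 - s k) * ‖P.edgeVec k‖) ^ 2 + r ^ 2) = ((1 - s k) * ‖P.edgeVec k‖) ^ 2 - r ^ 2 := by
    have hcos := cos_interiorAngle (P := P) (k := k) (by
      have := Real.pi_pos
      rcases hang (k + 1) with h | h <;> rw [h] <;> linarith)
    refine tangents_from_point (hU1 k) (hU1 (k + 1)) (mul_nonneg (hs0 _) (hℓ _).le)
      (mul_nonneg (by linarith [hs1 k]) (hℓ _).le) hr (hε1 k) (hε1 (k + 1)) ?_ ?_ ?_
    · have h1 := hεeq k
      have h2 := hεeq (k + 1)
      rw [← h1, ← h2, ← hst, ← hst]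
      unfold edgePoint
      have h3 := hU k
      have h4 := hU (k + 1)
      have h5 : P.vertex (k + 1) = P.vertex k + P.edgeVec k := by simp [edgeVec]
      rw [h5]
      push_cast
      linear_combination -(s k - 1) * h3 + s (k + 1) * h4
    · have h1 : P.cornerDot k = ‖P.edgeVec k‖ * ‖P.edgeVec (k + 1)‖ *
          ((U k).re * (U (k + 1)).re + (U k).im * (U (k + 1)).im) := by
        have e1 := congrArg Complex.re (hU k)
        have e2 := congrArg Complex.im (hU k)
        have e3 := congrArg Complex.re (hU (k + 1))
        have e4 := congrArg Complex.im (hU (k + 1))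
        simp only [Complex.re_ofReal_mul, Complex.im_ofReal_mul] at e1 e2 e3 e4
        rw [cornerDot, e1, e2, e3, e4]
        ring
      apply mul_right_cancel₀ (mul_pos (hℓ k) (hℓ (k + 1))).ne'
      rw [hcos, h1]
      ring
    · rcases hang (k + 1) with h | h <;> rw [h]
      · rw [Real.cos_pi_div_two]; norm_num
      · intro hcon
        rw [Real.cos_eq_one_iff_of_lt_of_lt] at hcon <;> linarith [Real.pi_pos]
  have hεall : ∀ k, ε k = ε 0 := by
    have h1 : ε 1 = ε 0 := (hcorner 0).2.1
    have h2 : ε 2 = ε 1 := (hcorner 1).2.1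
    have h3 : ε 3 = ε 2 := (hcorner 2).2.1
    have h4 : ε 4 = ε 3 := (hcorner 3).2.1
    intro k
    fin_cases k
    exacts [rfl, h1, h2.trans h1, h3.trans (h2.trans h1), h4.trans (h3.trans (h2.trans h1))]
  have hβ (k : Fin 5) : 0 ≤ s (k + 1) * ‖P.edgeVec (k + 1)‖ := mul_nonneg (hs0 _) (hℓ _).le
  have hperim : P.perimeter = ∑ k, ‖P.edgeVec k‖ := Finset.sum_congr rfl fun k _ => edgeLength_eq k
  -- The tangent length at vertex `k` is read off the edge leaving it; `hcorner` equates it with the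
  -- one on the edge arriving there and expresses it by `r` and the angle.
  refine ⟨r, fun k => s k * ‖P.edgeVec k‖, hr, fun k hk => ?_, fun k hk => ?_, ?_, ?_⟩
  · have h := hcorner (k - 1)
    have h0 := hβ (k - 1)
    rw [sub_add_cancel] at h h0
    obtain ⟨h1, -, h2⟩ := h
    rw [← h1, hk, Real.cos_pi_div_two] at h2
    exact (sq_eq_sq₀ h0 hr.le).1 (by linarith)
  · have h := hcorner (k - 1)
    have h0 := hβ (k - 1)
    rw [sub_add_cancel] at h h0
    obtain ⟨h1, -, h2⟩ := h
    have hcos : Real.cos (2 * Real.pi / 3) = -(1 / 2) := by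
      rw [show 2 * Real.pi / 3 = Real.pi - Real.pi / 3 by ring, Real.cos_pi_sub,
          Real.cos_pi_div_three]
    rw [← h1, hk, hcos] at h2
    refine (sq_eq_sq₀ (by positivity) hr.le).1 ?_
    rw [mul_pow, Real.sq_sqrt (by norm_num)]
    linarith
  · have e : ∑ k, (1 - s k) * ‖P.edgeVec k‖ = ∑ k, s k * ‖P.edgeVec k‖ := by
      rw [← Equiv.sum_comp (Equiv.addRight (1 : Fin 5)) (fun k => s k * ‖P.edgeVec k‖)]
      exact Finset.sum_congr rfl fun k _ => (hcorner k).1.symm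
    rw [hperim, two_mul]
    nth_rewrite 1 [← e]
    rw [← Finset.sum_add_distrib]
    exact Finset.sum_congr rfl fun k _ => by ring
  · have hsum : 2 * signedArea P.vertex = ε 0 * r * P.perimeter := by
      rw [← sum_cross_sub P c, hperim, Finset.mul_sum]
      refine Finset.sum_congr rfl fun k _ => ?_
      have h1 : P.vertex k - c = -(ε 0 * r * (Complex.I * U k)) - s k * P.edgeVec k := by
        rw [← hεall k, ← hεeq k, ← hst k, edgePoint]; ring
      have h2 : P.vertex (k + 1) - c = P.vertex k - c + P.edgeVec k := by simp [edgeVec]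
      have hu := norm_sq_eq (U k)
      rw [hU1] at hu
      have hUk := hU k
      rw [h2, cross_add_right, cross_self_right, h1]
      generalize ‖P.edgeVec k‖ = l at hUk ⊢
      rw [hUk]
      simp [cross]
      linear_combination -(ε 0 * r * l) * hu
    have harea := P.area_eq
    have h0 : 0 ≤ P.area := measureReal_nonneg
    have hpos := mul_pos hr (perimeter_pos (P := P))
    rw [show signedArea P.vertex = ε 0 * (r * P.perimeter / 2) by linarith] at harea
    -- The area is nonnegative while `r * P.perimeter` is positive, so the orientation must agree
    -- with `ε 0`.
    rcases orientation_eq (P := P) with ho | ho <;> rcases hε1 0 with he | he <;>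
      rw [ho, he] at harea <;> linarith

/-- A circumscribed unit-area pentagon with two right angles and three angles `2π/3`. -/
theorem IsCircumscribed.perimeter_sq (h : P.IsCircumscribed) (harea : P.area = 1)
    (hang : ∀ k, P.interiorAngle k = Real.pi / 2 ∨ P.interiorAngle k = 2 * Real.pi / 3)
    (hcard : {k | P.interiorAngle k = Real.pi / 2}.ncard = 2) :
    P.perimeter ^ 2 = 4 * (2 + √3) := by
  classical
  obtain ⟨r, L, hr, h1, h2, h3, h4⟩ := h.exists_tangentLength hang
  have hs3 : √3 ^ 2 = (3 : ℝ) := Real.sq_sqrt (by norm_num)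
  have hcard' : (Finset.univ.filter fun k => P.interiorAngle k = Real.pi / 2).card = 2 := by
    rw [← hcard, Set.ncard_eq_toFinset_card']
    congr 1
    ext k
    simp
  have hL (k : Fin 5) : L k = if P.interiorAngle k = Real.pi / 2 then r else r * √3 / 3 := by
    split_ifs with hk
    · exact h1 k hk
    · have := h2 k ((hang k).resolve_left hk)
      rw [← this]
      linear_combination -(L k / 3) * hs3
  have hcompl : (Finset.univ.filter fun k => ¬ P.interiorAngle k = Real.pi / 2).card = 3 := by
    have := Finset.card_filter_add_card_filter_not (s := Finset.univ)
      (fun k => P.interiorAngle k = Real.pi / 2)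
    rw [hcard'] at this
    simp at this ⊢
    omega
  -- Two tangents of length r and three of length r/√3. With p = 2(2+√3)r and area 1 = rp/2,
  -- eliminating `r` gives p² = 4(2+√3).
  have hsum : ∑ k, L k = (2 + √3) * r := by
    rw [Finset.sum_congr rfl fun k _ => hL k, Finset.sum_ite, Finset.sum_const, Finset.sum_const,
      hcard', hcompl]
    simp
    ring
  rw [hsum] at h3
  rw [harea] at h4
  linear_combination P.perimeter * h3 - 4 * (2 + √3) * h4

theorem right_angle_ne : Real.pi / 2 ≠ 2 * Real.pi / 3 := by
  have := Real.pi_pos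
  intro h
  linarith

theorem IsPrismatic.perimeter_sq (h : P.IsPrismatic) (harea : P.area = 1) :
    P.perimeter ^ 2 = 4 * (2 + √3) := by
  obtain ⟨hc, k, h0, h1, h2, h3, h4⟩ := h
  have hk : ∀ j : Fin 5, j = k ∨ j = k + 1 ∨ j = k + 2 ∨ j = k + 3 ∨ j = k + 4 := by
    clear h0 h1 h2 h3 h4; revert k; decide
  refine hc.perimeter_sq harea (fun j => ?_) ?_
  · rcases hk j with rfl | rfl | rfl | rfl | rfl <;> simp [*]
  · have : {j | P.interiorAngle j = Real.pi / 2} = {k, k + 1} := by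
      ext j
      show P.interiorAngle j = _ ↔ j = k ∨ j = k + 1
      rcases hk j with rfl | rfl | rfl | rfl | rfl <;> simp [*, right_angle_ne.symm]
    rw [this, Set.ncard_pair (by simp)]

theorem IsCairo.perimeter_sq (h : P.IsCairo) (harea : P.area = 1) :
    P.perimeter ^ 2 = 4 * (2 + √3) := by
  obtain ⟨hc, k, h0, h1, h2, h3, h4⟩ := h
  have hk : ∀ j : Fin 5, j = k ∨ j = k + 1 ∨ j = k + 2 ∨ j = k + 3 ∨ j = k + 4 := by
    clear h0 h1 h2 h3 h4; revert k; decide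
  refine hc.perimeter_sq harea (fun j => ?_) ?_
  · rcases hk j with rfl | rfl | rfl | rfl | rfl <;> simp [*]
  · have : {j | P.interiorAngle j = Real.pi / 2} = {k, k + 2} := by
      ext j
      show P.interiorAngle j = _ ↔ j = k ∨ j = k + 2
      rcases hk j with rfl | rfl | rfl | rfl | rfl <;> simp [*, right_angle_ne.symm]
    rw [this, Set.ncard_pair (by simp)]

end Pentagon

/-! ### Perimeter bounds for non-convex pentagons -/

theorem quadrilateral_isoperimetric_abs (a b c d : ℂ) (h : a + b + c + d = 0) :
    8 * |cross a b + cross c d| ≤ (‖a‖ + ‖b‖ + ‖c‖ + ‖d‖) ^ 2 := by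
  have h1 := quadrilateral_isoperimetric a b c d h
  have h2 := quadrilateral_isoperimetric d c b a (by linear_combination h)
  rw [cross_swap c d, cross_swap a b] at h2
  rw [show ‖d‖ + ‖c‖ + ‖b‖ + ‖a‖ = ‖a‖ + ‖b‖ + ‖c‖ + ‖d‖ by ring] at h2
  have : |cross a b + cross c d| ≤ (‖a‖ + ‖b‖ + ‖c‖ + ‖d‖) ^ 2 / 8 := abs_le.2 ⟨by linarith,
      by linarith⟩
  linarith

theorem signedArea_shift (v : Fin 5 → ℂ) (j : Fin 5) :
    signedArea (fun k => v (j + k)) = signedArea v := by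
  rw [signedArea, signedArea, ← Equiv.sum_comp (Equiv.addLeft j) (fun k => cross (v k) (v (k + 1)))]
  simp only [Equiv.coe_addLeft, add_assoc]

theorem closedLength_eq_sum (v : Fin 5 → ℂ) : closedLength v = ∑ k, ‖v (k + 1) - v k‖ := by
  rw [closedLength, Fin.sum_univ_five]; rfl

theorem closedLength_shift (v : Fin 5 → ℂ) (j : Fin 5) :
    closedLength (fun k => v (j + k)) = closedLength v := by
  rw [closedLength_eq_sum, closedLength_eq_sum,
    ← Equiv.sum_comp (Equiv.addLeft j) (fun k => ‖v (k + 1) - v k‖)]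
  simp only [Equiv.coe_addLeft, add_assoc]

theorem pentagon_isoperimetric_abs {T : ℝ} (hT : T ^ 2 = 5 - 2 * √5) (hT0 : 0 < T)
    (v : Fin 5 → ℂ) : 20 * T * |signedArea v| ≤ closedLength v ^ 2 := by
  have h1 := pentagon_isoperimetric hT hT0 v
  have h2 := pentagon_isoperimetric hT hT0 (fun k => (starRingEnd ℂ) (v k))
  have e1 : signedArea (fun k => (starRingEnd ℂ) (v k)) = -signedArea v := by
    simp only [signedArea_eq, cross, Complex.conj_re, Complex.conj_im]; ring
  have e2 : closedLength (fun k => (starRingEnd ℂ) (v k)) = closedLength v := by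
    simp only [closedLength, ← map_sub, RCLike.norm_conj]
  rw [e1, e2] at h2
  rcases abs_cases (signedArea v) with ⟨h, -⟩ | ⟨h, -⟩ <;> rw [h] <;> assumption

/-- The signed double area of a triangle. -/
def orient (a b c : ℂ) : ℝ := cross (b - a) (c - a)

/-- If one vertex can be cut off without decreasing the area, the quadrilateral bound applies. -/
theorem sixteen_le_of_orient_nonpos {v : Fin 5 → ℂ} {σ : ℝ} (hσ : |σ| = 1)
    (harea : σ * signedArea v = 1) (h : σ * orient (v 0) (v 1) (v 2) ≤ 0) :
    16 ≤ closedLength v ^ 2 := by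
  have hq := quadrilateral_isoperimetric_abs (v 2 - v 0) (v 3 - v 2) (v 4 - v 3) (v 0 - v 4)
      (by ring)
  have hs : 2 * signedArea v = orient (v 0) (v 1) (v 2) +
      (cross (v 2 - v 0) (v 3 - v 2) + cross (v 4 - v 3) (v 0 - v 4)) := by
    simp only [signedArea_eq, orient, cross, Complex.sub_re, Complex.sub_im]; ring
  set q := cross (v 2 - v 0) (v 3 - v 2) + cross (v 4 - v 3) (v 0 - v 4)
  have h1 : 2 ≤ |q| := by
    have : 2 ≤ σ * q := by
      have e : σ * (2 * signedArea v) = 2 := by linarith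
      rw [hs, mul_add] at e
      linarith
    have := le_abs_self (σ * q)
    rw [abs_mul, hσ, one_mul] at this
    linarith
  have ht := norm_add_le (v 2 - v 1) (v 1 - v 0)
  rw [sub_add_sub_cancel] at ht
  have : ‖v 2 - v 0‖ + ‖v 3 - v 2‖ + ‖v 4 - v 3‖ + ‖v 0 - v 4‖ ≤ closedLength v := by
    unfold closedLength; linarith
  calc (16 : ℝ) ≤ 8 * |q| := by linarith
    _ ≤ _ := hq
    _ ≤ _ := by gcongr

theorem triangle_bound {a b c : ℂ} {p σ : ℝ} (hσ : |σ| = 1) (h : 2 ≤ σ * orient a b c)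
    (hp : ‖b - a‖ + ‖c - b‖ + ‖c - a‖ ≤ p) : 432 ≤ p ^ 4 := by
  have ht := triangle_isoperimetric (b - a) (c - b)
  have e : cross (b - a) (c - b) = orient a b c := by
    simp only [orient, cross, Complex.sub_re, Complex.sub_im]; ring
  rw [e, show b - a + (c - b) = c - a by ring] at ht
  have h1 : 2 ≤ |orient a b c| := by
    have := le_abs_self (σ * orient a b c)
    rw [abs_mul, hσ, one_mul] at this
    linarith
  have h2 : 1 ≤ (orient a b c / 2) ^ 2 := by
    rw [div_pow, ← sq_abs]
    nlinarith
  calc (432 : ℝ) ≤ 432 * (orient a b c / 2) ^ 2 := by linarith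
    _ ≤ _ := ht
    _ ≤ _ := by gcongr

theorem triangle_le_closedLength (v : Fin 5 → ℂ) :
    ‖v 2 - v 0‖ + ‖v 4 - v 2‖ + ‖v 4 - v 0‖ ≤ closedLength v ∧
    ‖v 3 - v 0‖ + ‖v 4 - v 3‖ + ‖v 4 - v 0‖ ≤ closedLength v := by
  have h1 := norm_add_le (v 2 - v 1) (v 1 - v 0)
  have h2 := norm_add_le (v 4 - v 3) (v 3 - v 2)
  have h3 := norm_add_le (v 3 - v 2) (v 2 - v 0)
  simp only [sub_add_sub_cancel] at h1 h2 h3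
  rw [norm_sub_rev (v 4) (v 0)]
  unfold closedLength
  constructor <;> linarith

/-- Cutting off vertices 1 and 3 leaves the triangle 0, 2, 4, which has area at least 1 and no
larger perimeter. -/
theorem bound_of_two_nonadjacent {v : Fin 5 → ℂ} {σ : ℝ} (hσ : |σ| = 1)
    (harea : σ * signedArea v = 1) (h : σ * orient (v 0) (v 1) (v 2) ≤ 0)
    (h' : σ * orient (v 2) (v 3) (v 4) ≤ 0) : 432 ≤ closedLength v ^ 4 := by
  refine triangle_bound hσ ?_ (triangle_le_closedLength v).1
  have hs : 2 * signedArea v = orient (v 0) (v 1) (v 2) + orient (v 2) (v 3) (v 4) +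
      orient (v 0) (v 2) (v 4) := by
    simp only [signedArea_eq, orient, cross, Complex.sub_re, Complex.sub_im]; ring
  have e : σ * (2 * signedArea v) = 2 := by linarith
  rw [hs, mul_add, mul_add] at e
  linarith

/-- The triangle 0, 3, 4 has area at least 1. Otherwise the quadrilateral 0, 1, 2, 3 would have
positive signed area with nonpositive turns at 1 and 2, which forces its edges 01 and 23 to cross.
-/
theorem bound_of_two_adjacent {v : Fin 5 → ℂ} {σ : ℝ} (hσ : |σ| = 1)
    (harea : σ * signedArea v = 1) (h : σ * orient (v 0) (v 1) (v 2) ≤ 0)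
    (h' : σ * orient (v 1) (v 2) (v 3) ≤ 0)
    (hdisj : Disjoint (segment ℝ (v 0) (v 1)) (segment ℝ (v 2) (v 3))) :
    432 ≤ closedLength v ^ 4 := by
  have hs : 2 * signedArea v = orient (v 0) (v 1) (v 2) + orient (v 0) (v 2) (v 3) +
      orient (v 0) (v 3) (v 4) := by
    simp only [signedArea_eq, orient, cross, Complex.sub_re, Complex.sub_im]; ring
  have hs' : 2 * signedArea v = orient (v 1) (v 2) (v 3) + orient (v 0) (v 1) (v 3) +
      orient (v 0) (v 3) (v 4) := by
    simp only [signedArea_eq, orient, cross, Complex.sub_re, Complex.sub_im]; ring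
  refine triangle_bound (a := v 0) (b := v 3) (c := v 4) hσ ?_ (triangle_le_closedLength v).2
  by_contra hcon
  push Not at hcon
  have e : σ * (2 * signedArea v) = 2 := by linarith
  have e' := e
  rw [hs, mul_add, mul_add] at e
  rw [hs', mul_add, mul_add] at e'
  have h1 : 0 < σ * orient (v 0) (v 2) (v 3) := by linarith
  have h2 : 0 < σ * orient (v 0) (v 1) (v 3) := by linarith
  -- The coefficients of the affine dependence between the four points are signed triangle areas.
  -- With these signs, both sides of the dependence, once normalized, are the same convex
  -- combination point on 01 and on 23.
  obtain ⟨a₀, ha₀⟩ : ∃ a₀, a₀ = -(σ * orient (v 1) (v 2) (v 3)) := ⟨_, rfl⟩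
  obtain ⟨a₁, ha₁⟩ : ∃ a₁, a₁ = σ * orient (v 0) (v 2) (v 3) := ⟨_, rfl⟩
  obtain ⟨a₂, ha₂⟩ : ∃ a₂, a₂ = σ * orient (v 0) (v 1) (v 3) := ⟨_, rfl⟩
  obtain ⟨a₃, ha₃⟩ : ∃ a₃, a₃ = -(σ * orient (v 0) (v 1) (v 2)) := ⟨_, rfl⟩
  have hsum : a₀ + a₁ = a₂ + a₃ := by
    rw [ha₀, ha₁, ha₂, ha₃]
    simp only [orient, cross, Complex.sub_re, Complex.sub_im]; ring
  have hcomb : (a₀ : ℂ) * v 0 + a₁ * v 1 = a₂ * v 2 + a₃ * v 3 := by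
    rw [ha₀, ha₁, ha₂, ha₃]
    apply Complex.ext <;>
      simp [orient, cross] <;> ring
  have hS : 0 < a₀ + a₁ := by linarith
  have hS' : ((a₀ : ℂ) + a₁) ≠ 0 := by exact_mod_cast hS.ne'
  obtain ⟨z, hz⟩ : ∃ z : ℂ, z = (a₀ * v 0 + a₁ * v 1) / (a₀ + a₁) := ⟨_, rfl⟩
  refine (show z ∈ segment ℝ (v 0) (v 1) → z ∉ segment ℝ (v 2) (v 3) from
    fun h₁ => Set.disjoint_left.1 hdisj h₁) ?_ ?_
  · refine ⟨a₀ / (a₀ + a₁), a₁ / (a₀ + a₁), div_nonneg (by linarith) hS.le,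
      div_nonneg (by linarith) hS.le, by field_simp, ?_⟩
    rw [hz]
    simp only [Complex.real_smul]
    push_cast
    field_simp
  · refine ⟨a₂ / (a₀ + a₁), a₃ / (a₀ + a₁), div_nonneg (by linarith) hS.le,
      div_nonneg (by linarith) hS.le, by rw [hsum]; rw [hsum] at hS; field_simp, ?_⟩
    rw [hz, hcomb]
    simp only [Complex.real_smul]
    push_cast
    field_simp

namespace Pentagon

variable {P : Pentagon}

theorem abs_orientation : |P.orientation| = 1 := by
  rcases orientation_eq (P := P) with h | h <;> rw [h] <;> norm_num

theorem orient_nonpos {k : Fin 5} (h : Real.pi < P.interiorAngle (k + 1)) :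
    P.orientation * orient (P.vertex k) (P.vertex (k + 1)) (P.vertex (k + 1 + 1)) ≤ 0 := by
  have := cornerTurn_nonpos_of_pi_lt h
  unfold cornerTurn at this
  convert this using 2
  simp only [orient, edgeVec, cross, Complex.sub_re, Complex.sub_im]; ring

theorem orientation_mul_signedArea_shift (h : P.area = 1) (j : Fin 5) :
    P.orientation * signedArea (fun k => P.vertex (j + k)) = 1 := by
  rw [signedArea_shift, ← area_eq, h]

theorem four_le_perimeter (h : P.area = 1) (h1 : P.IsType1) : 4 ≤ P.perimeter := by
  obtain ⟨k, hk⟩ := Set.ncard_eq_one.1 h1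
  have hk' : Real.pi < P.interiorAngle k := (Set.ext_iff.1 hk k).2 rfl
  obtain ⟨j, rfl⟩ : ∃ j, k = j + 1 := ⟨k - 1, by simp⟩
  have := sixteen_le_of_orient_nonpos abs_orientation (orientation_mul_signedArea_shift h j) (by
    have := orient_nonpos hk'
    rwa [add_assoc, show (1 + 1 : Fin 5) = 2 from rfl, ← add_zero j, add_assoc, zero_add,
        add_assoc, zero_add] at this)
  rw [closedLength_shift, ← perimeter_eq] at this
  nlinarith [perimeter_pos (P := P)]

theorem disjoint_edges (j : Fin 5) : Disjoint (P.edge j) (P.edge (j + 2)) := by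
  rw [Set.disjoint_iff_inter_eq_empty, edge, edge, P.simple j (j + 2) (by simp)]
  rw [Set.eq_empty_iff_forall_notMem]
  have h1 : j ≠ j + 2 := by simp
  have h2 : j ≠ j + 2 + 1 := by revert j; decide
  have h3 : j + 1 ≠ j + 2 := by revert j; decide
  have h4 : j + 1 ≠ j + 2 + 1 := by revert j; decide
  rintro z ⟨rfl | rfl, h | h⟩
  exacts [h1 (P.injective h), h2 (P.injective h), h3 (P.injective h), h4 (P.injective h)]

/-- Two vertices in a cycle of five are either neighbours or two steps apart, so after a rotation
one of the two cutting lemmas applies. -/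
theorem le_perimeter_pow_four (h : P.area = 1) (h2 : P.IsType2) :
    432 ≤ P.perimeter ^ 4 := by
  obtain ⟨k, l, hkl, hk⟩ := Set.ncard_eq_two.1 h2
  have hk' : Real.pi < P.interiorAngle k := (Set.ext_iff.1 hk k).2 (Or.inl rfl)
  have hl' : Real.pi < P.interiorAngle l := (Set.ext_iff.1 hk l).2 (Or.inr rfl)
  have main (j : Fin 5) (h1 : Real.pi < P.interiorAngle (j + 1))
      (h2 : Real.pi < P.interiorAngle (j + 2) ∨ Real.pi < P.interiorAngle (j + 3)) :
      432 ≤ P.perimeter ^ 4 := by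
    rw [perimeter_eq, ← closedLength_shift _ j]
    have e2 : j + 1 + 1 = j + 2 := by clear h1 h2; revert j; decide
    have e3 : j + 2 + 1 = j + 3 := by clear h1 h2 e2; revert j; decide
    have e4 : j + 3 + 1 = j + 4 := by clear h1 h2 e2 e3; revert j; decide
    have o1 := orient_nonpos h1
    rw [e2] at o1
    rcases h2 with h2 | h2
    · rw [← e2] at h2
      have o2 := orient_nonpos h2
      rw [e2, e3] at o2
      refine bound_of_two_adjacent abs_orientation (orientation_mul_signedArea_shift h j)
        (by simpa using o1) o2 ?_
      have := disjoint_edges (P := P) j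
      rw [edge, edge, e3] at this
      simpa using this
    · rw [← e3] at h2
      have o2 := orient_nonpos h2
      rw [e3, e4] at o2
      exact bound_of_two_nonadjacent abs_orientation (orientation_mul_signedArea_shift h j)
        (by simpa using o1) o2
  have hcases : l = k + 1 ∨ l = k + 2 ∨ k = l + 1 ∨ k = l + 2 := by
    clear hk' hl' hk; revert k l; decide
  have d1 (k : Fin 5) : k = k - 1 + 1 := by simp
  have d2 (k : Fin 5) : k + 1 = k - 1 + 2 := by revert k; decide
  have d3 (k : Fin 5) : k + 2 = k - 1 + 3 := by revert k; decide
  rcases hcases with h | h | h | h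
  · exact main (k - 1) (d1 k ▸ hk') (Or.inl (by rw [← d2, ← h]; exact hl'))
  · exact main (k - 1) (d1 k ▸ hk') (Or.inr (by rw [← d3, ← h]; exact hl'))
  · exact main (l - 1) (d1 l ▸ hl') (Or.inl (by rw [← d2, ← h]; exact hk'))
  · exact main (l - 1) (d1 l ▸ hl') (Or.inr (by rw [← d3, ← h]; exact hk'))

theorem isoperimetric (h : P.area = 1) {T : ℝ} (hT : T ^ 2 = 5 - 2 * √5) (hT0 : 0 < T) :
    20 * T ≤ P.perimeter ^ 2 := by
  have h1 := pentagon_isoperimetric_abs hT hT0 P.vertex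
  have h2 : |signedArea P.vertex| = 1 := by
    have := congrArg abs (P.area_eq)
    rw [h, abs_one, abs_mul, abs_orientation, one_mul] at this
    exact this.symm
  rwa [h2, mul_one, ← perimeter_eq] at h1

end Pentagon

/-! ### Counting edges on the torus -/

/-- An edge is identified on the torus as a point set, so its endpoints must be recovered. In the
parametrization from `a`, the value 0 is a convex combination of the nonnegative parameters of `c`
and `d`, which forces one of them to vanish. -/
theorem eq_or_eq_of_segment_eq {a b c d : ℂ} (hab : a ≠ b) (h : segment ℝ a b = segment ℝ c d) :
    (c = a ∧ d = b) ∨ (c = b ∧ d = a) := by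
  have key : ∀ {a b c d : ℂ}, a ≠ b → segment ℝ a b = segment ℝ c d → a = c ∨ a = d := by
    intro a b c d hab h
    have ha : a ∈ segment ℝ c d := h ▸ left_mem_segment ℝ a b
    have hc : c ∈ segment ℝ a b := h ▸ left_mem_segment ℝ c d
    have hd : d ∈ segment ℝ a b := h ▸ right_mem_segment ℝ c d
    have par {z : ℂ} (hz : z ∈ segment ℝ a b) : ∃ s : ℝ, 0 ≤ s ∧ z = a + s * (b - a) := by
      obtain ⟨x, y, hx, hy, hxy, rfl⟩ := hz
      refine ⟨y, hy, ?_⟩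
      obtain rfl : x = 1 - y := by linarith
      simp only [Complex.real_smul]
      push_cast
      ring
    obtain ⟨s, hs, rfl⟩ := par hc
    obtain ⟨t, ht, rfl⟩ := par hd
    obtain ⟨x, y, hx, hy, hxy, hz⟩ := ha
    have h0 : ((x * s + y * t : ℝ) : ℂ) * (b - a) = 0 := by
      obtain rfl : x = 1 - y := by linarith
      simp only [Complex.real_smul] at hz
      push_cast at hz ⊢
      linear_combination hz
    have h1 : x * s + y * t = 0 := by
      exact_mod_cast (mul_eq_zero.1 h0).resolve_right (sub_ne_zero.2 hab.symm)
    have h2 : x * s = 0 := by nlinarith [mul_nonneg hx hs, mul_nonneg hy ht]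
    have h3 : y * t = 0 := by nlinarith [mul_nonneg hx hs, mul_nonneg hy ht]
    rcases mul_eq_zero.1 h2 with rfl | rfl
    · obtain rfl : y = 1 := by linarith
      right
      rw [one_mul] at h3
      simp [h3]
    · left; simp
  have h' : segment ℝ b a = segment ℝ c d := by rw [segment_symm, h]
  have hcd : c ≠ d := by
    rintro rfl
    rw [segment_same] at h
    have h1 : a ∈ ({c} : Set ℂ) := h ▸ left_mem_segment ℝ a b
    have h2 : b ∈ ({c} : Set ℂ) := h ▸ right_mem_segment ℝ a b
    exact hab (h1.trans h2.symm)
  rcases key hab h with h1 | h1 <;> rcases key hab.symm h' with h2 | h2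
  · exact absurd (h1.trans h2.symm) hab
  · exact Or.inl ⟨h1.symm, h2.symm⟩
  · exact Or.inr ⟨h2.symm, h1.symm⟩
  · exact absurd (h1.trans h2.symm) hab

namespace Pentagon

variable {P : Pentagon}

theorem edge_injective : Function.Injective P.edge := fun k l h => by
  by_contra hkl
  exact edgePoint_notMem (P := P) (Ne.symm hkl) (s := 1 / 2) (by norm_num) (by norm_num)
    (h ▸ edgePoint_mem (by norm_num) (by norm_num))

theorem eventually_edgePoint_mem_inside (k : Fin 5) : ∀ᶠ t : ℝ in 𝓝[>] 0,
    P.edgePoint k (1 / 2) + t * (P.orientation * (Complex.I * P.edgeVec k)) ∈ P.inside := by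
  obtain ⟨ε, hε, h⟩ := exists_ball_inside_of_edgePoint (P := P) k (s := 1 / 2) (by norm_num)
    (by norm_num)
  filter_upwards [eventually_ball (d := P.orientation * (Complex.I * P.edgeVec k))
    (Metric.mem_ball_self hε), eventually_side k (1 / 2) (orientation_ne_zero (P :=
        P))] with t h1 h2
  exact h _ h1 h2

/-- Midpoints of equal edges coincide and the edge vectors agree up to a sign. This sign times the
orientation of `P'` tells on which side of the common edge the tile lies. -/
theorem eventually_side_of_edge_eq {P' : Pentagon} {k m : Fin 5} {l : ℂ}
    (h : P.edge k = l +ᵥ P'.edge m) : ∃ s : Bool, ∀ᶠ t : ℝ in 𝓝[>] 0,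
      P.edgePoint k (1 / 2) + t * ((if s then 1 else -1) * (Complex.I * P.edgeVec k)) ∈
        l +ᵥ P'.inside := by
  have h0 : segment ℝ (P.vertex k) (P.vertex (k + 1)) =
      segment ℝ (l + P'.vertex m) (l + P'.vertex (m + 1)) := by
    rw [← segment_translate_image ℝ l]
    exact h
  have hev := eventually_edgePoint_mem_inside (P := P') m
  obtain ⟨e, he, hmid, hvec⟩ : ∃ e : ℝ, (e = 1 ∨ e = -1) ∧
      P.edgePoint k (1 / 2) = l + P'.edgePoint m (1 / 2) ∧ P'.edgeVec m = e * P.edgeVec k := by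
    unfold edgePoint edgeVec
    rcases eq_or_eq_of_segment_eq (vertex_ne k) h0 with ⟨h1, h2⟩ | ⟨h1, h2⟩ <;> rw [← h1, ← h2]
    · exact ⟨1, Or.inl rfl, by push_cast; ring, by push_cast; ring⟩
    · exact ⟨-1, Or.inr rfl, by push_cast; ring, by push_cast; ring⟩
  obtain ⟨s, hs⟩ : ∃ s : Bool, ((P'.orientation * e : ℝ) : ℂ) = if s then 1 else -1 := by
    rcases orientation_eq (P := P') with ho | ho <;> rcases he with he | he <;> rw [ho, he]
    · exact ⟨true, by simp⟩
    · exact ⟨false, by simp⟩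
    · exact ⟨false, by simp⟩
    · exact ⟨true, by simp⟩
  refine ⟨s, ?_⟩
  filter_upwards [hev] with t ht
  refine ⟨_, ht, ?_⟩
  rw [← hs, hmid, hvec]
  simp only [vadd_eq_add]
  push_cast
  ring

end Pentagon

namespace TorusTiling

open Pentagon

variable {Λ : Submodule ℤ ℂ} {n : ℕ} (T : TorusTiling Λ n)

/-- The edge of the tiling given by an edge of a tile. -/
def toEdge (y : Fin n × Fin 5) : T.Edge := Quotient.mk T.edgeSetoid y

/-- Every edge of the tiling belongs to at most two tiles. -/
theorem card_edge_le_two [DecidableEq T.Edge] (e : T.Edge) :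
    (Finset.univ.filter fun y : Fin n × Fin 5 => T.toEdge y = e).card ≤ 2 := by
  obtain ⟨x, rfl⟩ : ∃ x, T.toEdge x = e := Quotient.exists_rep e
  have h (y : Fin n × Fin 5) : ∃ s : Bool, T.toEdge y = T.toEdge x →
      ∃ l ∈ Λ, (T.tile x.1).edge x.2 = l +ᵥ (T.tile y.1).edge y.2 ∧
        ∀ᶠ t : ℝ in 𝓝[>] 0, (T.tile x.1).edgePoint x.2 (1 / 2) +
          t * ((if s then 1 else -1) * (Complex.I * (T.tile x.1).edgeVec x.2)) ∈
            l +ᵥ (T.tile y.1).inside := by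
    by_cases hy : T.toEdge y = T.toEdge x
    · obtain ⟨l, hl, hxy⟩ : ∃ l ∈ Λ, (T.tile x.1).edge x.2 = l +ᵥ (T.tile y.1).edge y.2 :=
        Quotient.exact (s := T.edgeSetoid) hy.symm
      obtain ⟨s, hs⟩ := eventually_side_of_edge_eq hxy
      exact ⟨s, fun _ => ⟨l, hl, hxy, hs⟩⟩
    · exact ⟨true, fun h => absurd h hy⟩
  choose s hs using h
  -- Each tile edge in the class is labelled by the side on which its tile lies. Two distinct lifted
  -- tiles with the same label would overlap close to the midpoint; for the same lift, the edges of
  -- a pentagon being distinct point sets gives the same index.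
  refine (Finset.card_le_card_of_injOn s (fun _ _ => Finset.mem_univ _) ?_ : _ ≤ (Finset.univ :
      Finset Bool).card)
  rintro y hy z hz hyz
  obtain ⟨l, hl, hey, hty⟩ := hs y (Finset.mem_filter.1 hy).2
  obtain ⟨l', hl', hez, htz⟩ := hs z (Finset.mem_filter.1 hz).2
  rw [← hyz] at htz
  obtain ⟨t, ht, ht'⟩ := (hty.and htz).exists
  by_cases hne : y.1 ≠ z.1 ∨ l' - l ≠ 0
  · exfalso
    have hd := T.disjoint y.1 z.1 (l' - l) (Λ.sub_mem hl' hl) hne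
    obtain ⟨a, ha, ha'⟩ := ht
    obtain ⟨b, hb, hb'⟩ := ht'
    refine Set.disjoint_left.1 hd ha ⟨b, hb, ?_⟩
    have e := ha'.trans hb'.symm
    simp only [vadd_eq_add] at e ⊢
    linear_combination -e
  · push Not at hne
    obtain ⟨h1, h2⟩ := hne
    obtain rfl : l' = l := sub_eq_zero.1 h2
    rw [hey, h1] at hez
    have h3 := edge_injective (vadd_left_cancel _ hez)
    exact Prod.ext h1 h3

/-- The edges of the tiles are grouped by the edge of the torus that they represent, with at most
two in each group. -/
theorem sum_perimeter_le : ∑ i, (T.tile i).perimeter ≤ 2 * T.perimeter := by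
  classical
  have : Finite T.Edge := inferInstanceAs (Finite (Quotient T.edgeSetoid))
  have := Fintype.ofFinite T.Edge
  have h1 : ∑ i, (T.tile i).perimeter = ∑ y : Fin n × Fin 5, (T.tile y.1).edgeLength y.2 := by
    rw [Fintype.sum_prod_type]; rfl
  rw [h1, perimeter, finsum_eq_sum_of_fintype, Finset.mul_sum,
    ← Finset.sum_fiberwise Finset.univ (fun y => T.toEdge y)]
  refine Finset.sum_le_sum fun e _ => ?_
  have h2 : ∀ y ∈ Finset.univ.filter fun y : Fin n × Fin 5 => T.toEdge y = e,
      (T.tile y.1).edgeLength y.2 = e.length := by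
    intro y hy
    rw [← (Finset.mem_filter.1 hy).2]
    rfl
  rw [Finset.sum_congr rfl h2, Finset.sum_const, nsmul_eq_mul]
  have h3 : 0 ≤ e.length := by
    obtain ⟨x, rfl⟩ := Quotient.exists_rep e
    exact dist_nonneg
  have h4 : ((Finset.univ.filter fun y : Fin n × Fin 5 =>
      T.toEdge y = e).card : ℝ) ≤ 2 := by
    exact_mod_cast T.card_edge_le_two e
  exact mul_le_mul_of_nonneg_right h4 h3

theorem fraction_mul (hn : n ≠ 0) (p : Pentagon → Prop) [DecidablePred p] :
    T.fraction p * n = ∑ i, if p (T.tile i) then (1 : ℝ) else 0 := by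
  have : (n : ℝ) ≠ 0 := by exact_mod_cast hn
  rw [fraction, div_mul_cancel₀ _ this, Set.ncard_eq_toFinset_card', Finset.sum_boole]
  congr 2
  ext i
  simp

end TorusTiling

/-! ### Numerical bounds, the inequality for one tile, and its average -/

namespace Pentagon

variable {P : Pentagon}

theorem le_perimeter_of_area_eq_one (h : P.area = 1) : 3.81192 ≤ P.perimeter := by
  have h5 : √5 ^ 2 = (5 : ℝ) := Real.sq_sqrt (by norm_num)
  have h50 : 0 ≤ √(5 : ℝ) := Real.sqrt_nonneg 5
  have h5' : √(5 : ℝ) ≤ 2.236068 := by nlinarith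
  have hpos : (0 : ℝ) < 5 - 2 * √5 := by linarith
  have hT := isoperimetric h (Real.sq_sqrt hpos.le) (Real.sqrt_pos.2 hpos)
  have hT' : 0.726542 ≤ √(5 - 2 * √5) := Real.le_sqrt_of_sq_le (by linarith)
  nlinarith [perimeter_pos (P := P)]

theorem IsPrismatic.perimeter_le (h : P.IsPrismatic) (harea : P.area = 1) :
    P.perimeter ≤ 3.86371 := by
  have h1 := h.perimeter_sq harea
  have h3 : √3 ^ 2 = (3 : ℝ) := Real.sq_sqrt (by norm_num)
  have h3' : √(3 : ℝ) ≤ 1.7320509 := by nlinarith [Real.sqrt_nonneg (3 : ℝ)]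
  nlinarith [perimeter_pos (P := P)]

/-- The failure of efficiency itself provides a unit-area Cairo pentagon of smaller perimeter, and
that perimeter equals the one of `Q`. No Cairo pentagon has to be constructed. -/
theorem lt_perimeter_of_not_isEfficient {Q : Pentagon} (hQ : Q.IsPrismatic) (hQarea : Q.area = 1)
    (h : P.area = 1) (hP : ¬ P.IsEfficient) : Q.perimeter < P.perimeter := by
  unfold IsEfficient at hP
  push Not at hP
  obtain ⟨R, hR, hRarea, hlt⟩ := hP h
  have : R.perimeter = Q.perimeter := (sq_eq_sq₀ perimeter_pos.le perimeter_pos.le).1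
    ((hR.perimeter_sq hRarea).trans (hQ.perimeter_sq hQarea).symm)
  rwa [← this]

/-- The divisor slightly exceeds 3.86371 − 3.81192 = 0.05179, so the right side is above −1 for
every tile, which settles efficient convex ones. For Type 1 it is at least (4 − 3.86371)/0.0518 >
2.6, for Type 2 at least (4.559 − 3.86371)/0.0518 > 13.4, and for other inefficient tiles it is
positive. -/
theorem perimeter_sub_gt {Q : Pentagon} (hQ : Q.IsPrismatic) (hQarea : Q.area = 1)
    (h : P.area = 1) [Decidable P.IsEfficient] [Decidable P.IsType1] [Decidable P.IsType2] :
    2.6 * (if P.IsType1 then 1 else 0) + 13.4 * (if P.IsType2 then 1 else 0) -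
      (if P.IsEfficient then 1 else 0) < (P.perimeter - Q.perimeter) / 0.0518 := by
  have hQ' := hQ.perimeter_le hQarea
  have hP' := le_perimeter_of_area_eq_one h
  rw [lt_div_iff₀ (by norm_num)]
  by_cases h1 : P.IsType1
  · have h2 : ¬ P.IsType2 := fun h2 => by
      have := h1.symm.trans h2
      norm_num at this
    have := four_le_perimeter h h1
    simp only [h1, h2, if_true, if_false]
    split_ifs <;> linarith
  by_cases h2 : P.IsType2
  · have h4 := le_perimeter_pow_four h h2
    have : 4.559 ≤ P.perimeter := by
      by_contra hcon
      push Not at hcon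
      have := pow_lt_pow_left₀ hcon perimeter_pos.le (n := 4) (by norm_num)
      norm_num at this
      linarith
    simp only [h1, h2, if_true, if_false]
    split_ifs <;> linarith
  by_cases h3 : P.IsEfficient
  · simp only [h1, h2, h3, if_true, if_false]
    linarith
  · have := lt_perimeter_of_not_isEfficient hQ hQarea h h3
    simp only [h1, h2, h3, if_false]
    linarith

end Pentagon

theorem proposition2p7
    (Λ : Submodule ℤ ℂ) [DiscreteTopology Λ] [IsZLattice ℝ Λ]
    (n : ℕ) (T : TorusTiling Λ n)
    (hunit : ∀ i, (T.tile i).area = 1)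
    (Q : Pentagon) (hQ : Q.IsPrismatic) (hQarea : Q.area = 1)
    (hper : T.perimeter / n ≤ Q.perimeter / 2) :
    T.fraction Pentagon.IsEfficient >
      2.6 * T.fraction Pentagon.IsType1 + 13.4 * T.fraction Pentagon.IsType2 := by
  classical
  -- Some tile covers the origin, so `n ≠ 0` and the sum of strict inequalities is strict.
  obtain ⟨i₀, -⟩ := T.covers 0
  have hn : n ≠ 0 := i₀.pos.ne'
  have hn' : (0 : ℝ) < n := by exact_mod_cast i₀.pos
  have hsum : ∑ i, ((T.tile i).perimeter - Q.perimeter) / 0.0518 ≤ 0 := by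
    rw [← Finset.sum_div, Finset.sum_sub_distrib, Finset.sum_const, Finset.card_univ,
        Fintype.card_fin,
      nsmul_eq_mul]
    have := T.sum_perimeter_le
    rw [div_le_iff₀ hn'] at hper
    exact div_nonpos_of_nonpos_of_nonneg (by linarith) (by norm_num)
  have hlt := Finset.sum_lt_sum_of_nonempty (s := Finset.univ) ⟨i₀, Finset.mem_univ _⟩ fun i _ =>
    Pentagon.perimeter_sub_gt hQ hQarea (hunit i)
  rw [Finset.sum_sub_distrib, Finset.sum_add_distrib, ← Finset.mul_sum, ← Finset.mul_sum,
    ← T.fraction_mul hn, ← T.fraction_mul hn, ← T.fraction_mul hn] at hlt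
  refine lt_of_mul_lt_mul_right (a := (n : ℝ)) ?_ hn'.le
  linarith
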